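/- Computation takes place on a real RAM: a while-program working on arrays of natural numbers (with addition, truncated subtraction and comparison) and on arrays of exact real numbers (with $+,-,\times,/$, comparison, and rational constants only), with cells addressed by computed natural numbers; each operation, constant, memory access and test costs one step. The input is a pair $(n,k)$ together with the coordinates of points $v_1,\dots,v_{n+k}\in\mathbb{R}^n$. **Theorem.** There is a real RAM program (the same for all $n$ and $k$) such that for every integer $k\ge 1$ there is a constant $C$, depending only on $k$, with the following property. For every $n\ge 1$ and all points $v_1,\dots,v_{n+k}\in\mathbb{R}^n$ (for instance, the $n+k$ vertices of a $\mathcal V$-polytope) such that the origin is an interior point of $P=\mathrm{conv}\{v_1,\dots,v_{n+k}\}$, the program halts after at most $C\,n^{k+3}$ steps, having computed the exact volume $\mathrm{Vol}(P)$ by a decomposition of $P$ into simplices. That is, it outputs a real number $S$ and a list $U_1,\dots,U_m$ of $n$-subsets of the index set $\{1,\dots,n+k\}$ such that 1. for each $l$ the points $v_j$, $j\in U_l$, span a facet of $P$, i.e. they are affinely independent and lie on a common supporting hyperplane of $P$; 2. the simplices $\mathrm{conv}(\{0\}\cup\{v_j: j\in U_l\})$, $l=1,\dots,m$, have pairwise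 disjoint interiors and their union is $P$; 3. $S=\sum_{l=1}^m \frac{|\det M_{U_l}|}{n!}=\mathrm{Vol}(P)$, where $M_{U_l}$ is the matrix with columns $v_j$, $j\in U_l$. -/

import Mathlib

/-! ## A real RAM

Programs are while-programs over two sorts of data, natural numbers (used for indices and
counters) and exact real numbers. For each sort the memory consists of arrays `0, 1, 2, …`,
each with cells `0, 1, 2, …`; a scalar variable is cell `0` of some array. Natural numbers
support addition, truncated subtraction and comparison only; real numbers support
`+, -, *, /` and comparison. There is no conversion between the sorts, and the only real
constants are rational. Every operation, constant, memory access and test costs one step. -/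

namespace RealRAM

/-- The contents of the memory: `nat a i` and `real a i` are cell `i` of array `a`. -/
structure State where
  nat : ℕ → ℕ → ℕ
  real : ℕ → ℕ → ℝ

/-- Natural number expressions. -/
inductive NExpr where
  | const (c : ℕ)
  | get (a : ℕ) (i : NExpr)
  | add (x y : NExpr)
  | sub (x y : NExpr)

/-- Real expressions. -/
inductive RExpr where
  | const (q : ℚ)
  | get (a : ℕ) (i : NExpr)
  | add (x y : RExpr)
  | sub (x y : RExpr)
  | mul (x y : RExpr)
  | div (x y : RExpr)

/-- Tests. -/
inductive Test where
  | nle (x y : NExpr)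
  | rle (x y : RExpr)
  | not (b : Test)
  | and (b c : Test)

/-- Programs. -/
inductive Prog where
  | skip
  | setNat (a : ℕ) (i e : NExpr)
  | setReal (a : ℕ) (i : NExpr) (e : RExpr)
  | seq (p q : Prog)
  | cond (b : Test) (p q : Prog)
  | while (b : Test) (p : Prog)

/-- The value of a natural number expression. -/
def NExpr.eval (s : State) : NExpr → ℕ
  | const c => c
  | get a i => s.nat a (i.eval s)
  | add x y => x.eval s + y.eval s
  | sub x y => x.eval s - y.eval s

/-- The number of steps of the evaluation of a natural number expression. -/
def NExpr.cost : NExpr → ℕ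
  | const _ => 1
  | get _ i => i.cost + 1
  | add x y => x.cost + y.cost + 1
  | sub x y => x.cost + y.cost + 1

/-- The value of a real expression (a division by zero returns zero). -/
noncomputable def RExpr.eval (s : State) : RExpr → ℝ
  | const q => (q : ℝ)
  | get a i => s.real a (i.eval s)
  | add x y => x.eval s + y.eval s
  | sub x y => x.eval s - y.eval s
  | mul x y => x.eval s * y.eval s
  | div x y => x.eval s / y.eval s

/-- The number of steps of the evaluation of a real expression. -/
def RExpr.cost : RExpr → ℕ
  | const _ => 1
  | get _ i => i.cost + 1
  | add x y => x.cost + y.cost + 1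
  | sub x y => x.cost + y.cost + 1
  | mul x y => x.cost + y.cost + 1
  | div x y => x.cost + y.cost + 1

/-- The truth of a test. -/
def Test.Holds (s : State) : Test → Prop
  | nle x y => x.eval s ≤ y.eval s
  | rle x y => x.eval s ≤ y.eval s
  | not b => ¬ b.Holds s
  | and b c => b.Holds s ∧ c.Holds s

/-- The number of steps of the evaluation of a test. -/
def Test.cost : Test → ℕ
  | nle x y => x.cost + y.cost + 1
  | rle x y => x.cost + y.cost + 1
  | not b => b.cost + 1
  | and b c => b.cost + c.cost + 1

/-- Write the natural number `v` into cell `i` of array `a`. -/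
def State.writeNat (s : State) (a i v : ℕ) : State where
  nat := Function.update s.nat a (Function.update (s.nat a) i v)
  real := s.real

/-- Write the real number `v` into cell `i` of array `a`. -/
def State.writeReal (s : State) (a i : ℕ) (v : ℝ) : State where
  nat := s.nat
  real := Function.update s.real a (Function.update (s.real a) i v)

/-- `Exec p s t s'`: the program `p`, started in state `s`, halts after exactly `t` steps
in state `s'`. -/
inductive Exec : Prog → State → ℕ → State → Prop where
  | skip (s : State) : Exec Prog.skip s 1 s
  | setNat (a : ℕ) (i e : NExpr) (s : State) :
      Exec (Prog.setNat a i e) s (i.cost + e.cost + 1)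
        (s.writeNat a (i.eval s) (e.eval s))
  | setReal (a : ℕ) (i : NExpr) (e : RExpr) (s : State) :
      Exec (Prog.setReal a i e) s (i.cost + e.cost + 1)
        (s.writeReal a (i.eval s) (e.eval s))
  | seq {p q : Prog} {s s' s'' : State} {t t' : ℕ} :
      Exec p s t s' → Exec q s' t' s'' → Exec (Prog.seq p q) s (t + t') s''
  | cond_true {b : Test} {p q : Prog} {s s' : State} {t : ℕ} :
      b.Holds s → Exec p s t s' → Exec (Prog.cond b p q) s (b.cost + t + 1) s'
  | cond_false {b : Test} {p q : Prog} {s s' : State} {t : ℕ} :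
      ¬ b.Holds s → Exec q s t s' → Exec (Prog.cond b p q) s (b.cost + t + 1) s'
  | while_true {b : Test} {p : Prog} {s s' s'' : State} {t t' : ℕ} :
      b.Holds s → Exec p s t s' → Exec (Prog.while b p) s' t' s'' →
        Exec (Prog.while b p) s (b.cost + t + 1 + t') s''
  | while_false {b : Test} {p : Prog} {s : State} :
      ¬ b.Holds s → Exec (Prog.while b p) s (b.cost + 1) s

end RealRAM

/-! ## Polytopes given by points, and their decompositions into simplices -/

/-- The convex hull of the points `V 0, …, V (N - 1)` of `ℝⁿ`. -/
def vPolytope {n N : ℕ} (V : Fin N → Fin n → ℝ) : Set (Fin n → ℝ) :=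
  convexHull ℝ (Set.range V)

/-- The points `V (u 0), …, V (u (n - 1))` span a facet of `conv V`: they are affinely
independent and lie on a common supporting hyperplane of `conv V`. -/
def SpansFacet {n N : ℕ} (V : Fin N → Fin n → ℝ) (u : Fin n → Fin N) : Prop :=
  AffineIndependent ℝ (fun i => V (u i)) ∧
    ∃ (a : Fin n → ℝ) (b : ℝ), a ≠ 0 ∧ (∀ i, a ⬝ᵥ V (u i) = b) ∧
      ∀ x ∈ vPolytope V, a ⬝ᵥ x ≤ b

/-- The simplex with vertices `0, V (u 0), …, V (u (n - 1))`. -/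
def coneSimplex {n N : ℕ} (V : Fin N → Fin n → ℝ) (u : Fin n → Fin N) :
    Set (Fin n → ℝ) :=
  convexHull ℝ (insert 0 (Set.range fun i => V (u i)))

/-- The matrix with columns `V (u 0), …, V (u (n - 1))`. -/
def columnMatrix {n N : ℕ} (V : Fin N → Fin n → ℝ) (u : Fin n → Fin N) :
    Matrix (Fin n) (Fin n) ℝ :=
  Matrix.of fun r c => V (u c) r

/-- The `n`-subfamilies `U 0, …, U (m - 1)` of the points `V` span facets of `conv V`, and the
simplices that they span with the origin decompose `conv V`. -/
structure IsDecomposition {n N m : ℕ} (V : Fin N → Fin n → ℝ)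
    (U : Fin m → Fin n → Fin N) : Prop where
  spansFacet : ∀ l, SpansFacet V (U l)
  iUnion_eq : ⋃ l, coneSimplex V (U l) = vPolytope V
  disjoint : Pairwise fun l l' =>
    Disjoint (interior (coneSimplex V (U l))) (interior (coneSimplex V (U l')))

/-! ## Input and output -/

/-- The initial memory for the points `V 0, …, V (n + k - 1)` of `ℝⁿ`: natural arrays `0` and `1`
start with `n` and `k`, real array `0` lists the coordinates of `V 0`, then those of `V 1`, and
so on; all other cells are zero. -/
noncomputable def inputState {n k : ℕ} (V : Fin (n + k) → Fin n → ℝ) : RealRAM.State where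
  nat a i := if a = 0 ∧ i = 0 then n else if a = 1 ∧ i = 0 then k else 0
  real a i :=
    if h : a = 0 ∧ i < (n + k) * n then
      V (Fin.divNat ⟨i, h.2⟩) (Fin.modNat ⟨i, h.2⟩)
    else 0

/-- The real output is the first cell of real array `1`. -/
def realOutput (s : RealRAM.State) : ℝ := s.real 1 0

/-- The number of listed simplices is the first cell of natural array `2`. -/
def simplexCount (s : RealRAM.State) : ℕ := s.nat 2 0

/-- Natural array `3` lists the `n` indices of the first simplex, then those of the second one,
and so on. -/
def ListsSimplices {n N : ℕ} (s : RealRAM.State)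
    (U : Fin (simplexCount s) → Fin n → Fin N) : Prop :=
  ∀ (l : Fin (simplexCount s)) (i : Fin n), s.nat 3 ((l : ℕ) * n + i) = (U l i : ℕ)

/-! Put `N = n + k`. A simplex of the decomposition is known from the `k` indices that it omits.
Hence it suffices to run through all `N ^ k` tuples of `k` indices, to keep the increasing ones, and
to decide within `O(N ^ 3)` steps whether the complementary `n`-set `U` is to be used. Since `N ≤ (k
+ 1) n`, the total `O(N ^ (k + 3))` is `n ^ (k + 3)` up to a factor depending on `k`.

Facets of `P` need not be simplices, so they must be triangulated consistently although every `U` is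
judged on its own. This is done by a lexicographic perturbation. Give the point `V j` the cost `c j
= 1 + ε ^ (j + 1)` and, for a vector `x`, maximise `a ⬝ᵥ x` subject to `a ⬝ᵥ V j ≤ c j` for all `j`.
The feasible region is compact because the origin is interior to `P`. For generic costs a vertex of
the region is tight at exactly `n` indices `U`, and if it is optimal then `x` lies in the cone over
`V (U i)` (`exists_dualFeasible`). So the cones of the feasible bases cover the space. Two of them
have no common interior point, as each of the two bases would give the strictly smaller objective
value (`disjoint_interior_coneSimplex`).

No number `ε` enters the program. The slack of the constraint `j` at the basis `U` is a polynomial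
in `ε`, whose sign for small `ε > 0` is that of its first nonzero coefficient. Apart from the
constant term and one coefficient `1`, its coefficients are the negated coordinates of `V j` with
respect to `U`. Feasibility thus becomes the sign condition `LexFeasible`, and
`exists_perturbed_costs` supplies one `ε` for which both notions agree for all bases. The constant
terms say that `U` lies on a supporting hyperplane `a ⬝ᵥ y = 1` of `P`, so that `P` meets the cone
of `U` in exactly the simplex (`isDecomposition_of_lexFeasible`).

The coordinates and the determinant come from Gauss–Jordan elimination (`Eliminated.det_eq`). A
simplex is a linear image of the corner of the cube, whose volume `1 / n!` is read off from the `ℓ¹`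
ball, and overlaps are null sets because convex sets have null frontiers
(`IsDecomposition.volume_eq`). The program is verified with the triples `Runs`, which bound the
steps, together with loop invariants. -/

namespace RealRAM

/-! ### Correctness and running time of programs -/

/-- `p`, started in `s`, halts within `T` steps in a state that satisfies `Q`. -/
def Runs (p : Prog) (T : ℕ) (s : State) (Q : State → Prop) : Prop :=
  ∃ t s', Exec p s t s' ∧ t ≤ T ∧ Q s'

/-- The natural arrays that a program may write to. -/
def Prog.natWrites : Prog → List ℕ
  | skip => []
  | setNat a _ _ => [a]
  | setReal _ _ _ => []
  | seq p q => p.natWrites ++ q.natWrites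
  | cond _ p q => p.natWrites ++ q.natWrites
  | .while _ p => p.natWrites

/-- The real arrays that a program may write to. -/
def Prog.realWrites : Prog → List ℕ
  | skip => []
  | setNat _ _ _ => []
  | setReal a _ _ => [a]
  | seq p q => p.realWrites ++ q.realWrites
  | cond _ p q => p.realWrites ++ q.realWrites
  | .while _ p => p.realWrites

/-- `s'` differs from `s` only in arrays that `p` may write to. -/
def Frame (p : Prog) (s s' : State) : Prop :=
  (∀ a, a ∉ p.natWrites → s'.nat a = s.nat a) ∧ (∀ a, a ∉ p.realWrites → s'.real a = s.real a)

/-- The write sets are syntactic, so for concrete programs the preservation of an array is a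
decidable fact, and loop invariants need only mention what the loop changes. -/
theorem Exec.frame {p : Prog} {s s' : State} {t : ℕ} (h : Exec p s t s') : Frame p s s' := by
  induction h with
  | skip s => exact ⟨fun _ _ => rfl, fun _ _ => rfl⟩
  | setNat a i e s =>
    refine ⟨fun b hb => ?_, fun _ _ => rfl⟩
    simp only [Prog.natWrites, List.mem_singleton] at hb
    simp [State.writeNat, hb]
  | setReal a i e s =>
    refine ⟨fun _ _ => rfl, fun b hb => ?_⟩
    simp only [Prog.realWrites, List.mem_singleton] at hb
    simp [State.writeReal, hb]
  | seq _ _ h1 h2 =>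
    refine ⟨fun b hb => ?_, fun b hb => ?_⟩
    · simp only [Prog.natWrites, List.mem_append, not_or] at hb
      rw [h2.1 b hb.2, h1.1 b hb.1]
    · simp only [Prog.realWrites, List.mem_append, not_or] at hb
      rw [h2.2 b hb.2, h1.2 b hb.1]
  | cond_true _ _ h =>
    refine ⟨fun b hb => ?_, fun b hb => ?_⟩
    · simp only [Prog.natWrites, List.mem_append, not_or] at hb
      exact h.1 b hb.1
    · simp only [Prog.realWrites, List.mem_append, not_or] at hb
      exact h.2 b hb.1
  | cond_false _ _ h =>
    refine ⟨fun b hb => ?_, fun b hb => ?_⟩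
    · simp only [Prog.natWrites, List.mem_append, not_or] at hb
      exact h.1 b hb.2
    · simp only [Prog.realWrites, List.mem_append, not_or] at hb
      exact h.2 b hb.2
  | while_true _ _ _ h1 h2 =>
    refine ⟨fun b hb => ?_, fun b hb => ?_⟩
    · rw [h2.1 b hb, h1.1 b (by simpa [Prog.natWrites] using hb)]
    · rw [h2.2 b hb, h1.2 b (by simpa [Prog.realWrites] using hb)]
  | while_false _ => exact ⟨fun _ _ => rfl, fun _ _ => rfl⟩

theorem Runs.frame {p : Prog} {T : ℕ} {s : State} {Q : State → Prop} (h : Runs p T s Q) :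
    Runs p T s (fun s' => Q s' ∧ Frame p s s') := by
  obtain ⟨t, s', he, ht, hq⟩ := h
  exact ⟨t, s', he, ht, hq, he.frame⟩

theorem Runs.mono {p : Prog} {T T' : ℕ} {s : State} {Q Q' : State → Prop} (h : Runs p T s Q)
    (hT : T ≤ T') (hQ : ∀ s', Q s' → Q' s') : Runs p T' s Q' := by
  obtain ⟨t, s', he, ht, hq⟩ := h
  exact ⟨t, s', he, ht.trans hT, hQ _ hq⟩

theorem Runs.mono_frame {p : Prog} {T T' : ℕ} {s : State} {Q Q' : State → Prop} (h : Runs p T s Q)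
    (hT : T ≤ T') (hQ : ∀ s', Q s' → Frame p s s' → Q' s') : Runs p T' s Q' :=
  h.frame.mono hT fun s' hs => hQ s' hs.1 hs.2

theorem runs_skip {T : ℕ} {s : State} {Q : State → Prop} (hT : 1 ≤ T) (hQ : Q s) :
    Runs Prog.skip T s Q := ⟨1, s, Exec.skip s, hT, hQ⟩

theorem runs_setNat {a : ℕ} {i e : NExpr} {T : ℕ} {s : State} {Q : State → Prop}
    (hT : i.cost + e.cost + 1 ≤ T) (hQ : Q (s.writeNat a (i.eval s) (e.eval s))) :
    Runs (Prog.setNat a i e) T s Q := ⟨_, _, Exec.setNat a i e s, hT, hQ⟩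

theorem runs_setReal {a : ℕ} {i : NExpr} {e : RExpr} {T : ℕ} {s : State} {Q : State → Prop}
    (hT : i.cost + e.cost + 1 ≤ T) (hQ : Q (s.writeReal a (i.eval s) (e.eval s))) :
    Runs (Prog.setReal a i e) T s Q := ⟨_, _, Exec.setReal a i e s, hT, hQ⟩

theorem runs_seq {p q : Prog} {T₁ T₂ T : ℕ} {s : State} {Q : State → Prop}
    (h : Runs p T₁ s fun s' => Runs q T₂ s' Q) (hT : T₁ + T₂ ≤ T) : Runs (Prog.seq p q) T s Q := by
  obtain ⟨t, s', he, ht, t', s'', he', ht', hq⟩ := h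
  exact ⟨_, _, Exec.seq he he', by omega, hq⟩

theorem runs_cond {b : Test} {p q : Prog} {T T' : ℕ} {s : State} {Q : State → Prop}
    (hT : b.cost + T + 1 ≤ T') (hp : b.Holds s → Runs p T s Q) (hq : ¬ b.Holds s → Runs q T s Q) :
    Runs (Prog.cond b p q) T' s Q := by
  by_cases hb : b.Holds s
  · obtain ⟨t, s', he, ht, hs⟩ := hp hb
    exact ⟨_, _, Exec.cond_true hb he, by omega, hs⟩
  · obtain ⟨t, s', he, ht, hs⟩ := hq hb
    exact ⟨_, _, Exec.cond_false hb he, by omega, hs⟩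

/-- The scalar natural variable held in cell `0` of array `a`. -/
def nvar (a : ℕ) : NExpr := NExpr.get a (NExpr.const 0)

/-- The scalar real variable held in cell `0` of array `a`. -/
def rvar (a : ℕ) : RExpr := RExpr.get a (NExpr.const 0)

/-- Assignment to a scalar natural variable. -/
def assignNat (a : ℕ) (e : NExpr) : Prog := Prog.setNat a (NExpr.const 0) e

/-- Assignment to a scalar real variable. -/
def assignReal (a : ℕ) (e : RExpr) : Prog := Prog.setReal a (NExpr.const 0) e

/-- `for a := 0 to bound - 1 do body`. -/
def forLoop (a bound : ℕ) (body : Prog) : Prog :=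
  Prog.seq (assignNat a (NExpr.const 0))
    (Prog.while (Test.not (Test.nle (nvar bound) (nvar a)))
      (Prog.seq body (assignNat a (NExpr.add (nvar a) (NExpr.const 1)))))

/-- The invariant `I i` holds before round `i` of a for-loop. -/
theorem runs_forLoop {a bound : ℕ} {body : Prog} {T T' b : ℕ} {s : State} {Q : State → Prop}
    (I : ℕ → State → Prop) (hab : a ≠ bound) (hab' : a ∉ body.natWrites)
    (hbb : bound ∉ body.natWrites)
    (hI : ∀ i s v, I i s → I i (s.writeNat a 0 v)) (hb : s.nat bound 0 = b)
    (h0 : I 0 s)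
    (hstep : ∀ i s', i < b → I i s' → s'.nat a 0 = i → Frame (forLoop a bound body) s s' →
      Runs body T s' (fun s'' => I (i + 1) s''))
    (hT : b * (T + 13) + 10 ≤ T')
    (hQ : ∀ s', I b s' → Frame (forLoop a bound body) s s' → Q s') :
    Runs (forLoop a bound body) T' s Q := by
  -- Induction on the number `j` of rounds left. A round costs `T` for the body, 6 for the test, 6
  -- for the increment and 1 for the loop; the failing test at the end costs 7, and the
  -- initialisation 3.
  have main : ∀ j i s', i + j = b → I i s' → s'.nat a 0 = i → Frame (forLoop a bound body) s s' →
      Runs (Prog.while (Test.not (Test.nle (nvar bound) (nvar a)))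
      (Prog.seq body (assignNat a (NExpr.add (nvar a) (NExpr.const 1))))) (j * (T + 13) + 7) s'
      (I b) := by
    intro j
    induction j with
    | zero =>
      intro i s' hij hi ha hf
      have hbs : s'.nat bound 0 = b := by
        rw [hf.1 bound ?_, hb]
        simp [forLoop, Prog.natWrites, assignNat, hbb, hab.symm]
      refine ⟨_, s', Exec.while_false ?_, ?_, ?_⟩
      · simp [Test.Holds, nvar, NExpr.eval, hbs, ha]; omega
      · simp [Test.cost, nvar, NExpr.cost]
      · obtain rfl : i = b := by omega
        exact hi
    | succ j ih =>
      intro i s' hij hi ha hf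
      have hbs : s'.nat bound 0 = b := by
        rw [hf.1 bound ?_, hb]
        simp [forLoop, Prog.natWrites, assignNat, hbb, hab.symm]
      obtain ⟨t, s1, he, ht, hs1⟩ := hstep i s' (by omega) hi ha hf
      have hf1 := he.frame
      have ha1 : s1.nat a 0 = i := by rw [hf1.1 a hab', ha]
      obtain ⟨t2, s2, he2, ht2, hs2⟩ := ih (i + 1) (s1.writeNat a 0 (i + 1)) (by omega)
        (hI _ _ _ hs1) (by simp [State.writeNat]) (by
          refine ⟨fun c hc => ?_, fun c hc => ?_⟩
          · have h1 := hf.1 c hc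
            simp only [forLoop, Prog.natWrites, assignNat, List.mem_append, not_or,
              List.mem_singleton] at hc
            rw [← h1, ← hf1.1 c hc.2.1]
            simp [State.writeNat, hc.1]
          · have h1 := hf.2 c hc
            simp only [forLoop, Prog.realWrites, assignNat, List.mem_append, not_or] at hc
            rw [← h1, ← hf1.2 c hc.2.1]
            simp [State.writeNat])
      have he3 : Exec (assignNat a (NExpr.add (nvar a) (NExpr.const 1))) s1 6
          (s1.writeNat a 0 (i + 1)) := by
        have := Exec.setNat a (NExpr.const 0) (NExpr.add (nvar a) (NExpr.const 1)) s1
        simpa [NExpr.eval, nvar, NExpr.cost, ha1, assignNat] using this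
      refine ⟨_, s2, Exec.while_true ?_ (Exec.seq he he3) he2, ?_, hs2⟩
      · simp [Test.Holds, nvar, NExpr.eval, hbs, ha]; omega
      · simp [Test.cost, nvar, NExpr.cost]
        ring_nf at ht2 ⊢
        omega
  have h1 := main b 0 (s.writeNat a 0 0) (by omega) (hI _ _ _ h0) (by simp [State.writeNat])
    (by
      refine ⟨fun c hc => ?_, fun c hc => rfl⟩
      simp only [forLoop, Prog.natWrites, assignNat, List.mem_append, not_or,
              List.mem_singleton] at hc
      simp [State.writeNat, hc.1])
  have h2 : Runs (forLoop a bound body) T' s (I b) := by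
    refine runs_seq (T₁ := 3) (T₂ := b * (T + 13) + 7) (runs_setNat (by simp [NExpr.cost]) ?_)
      (by omega)
    simpa [NExpr.eval] using h1
  exact h2.mono_frame le_rfl hQ

end RealRAM

/-! ### Gauss–Jordan elimination -/

section

open Matrix

/-- The matrix `A` with row `i` replaced by the sum of row `i` and `t` times row `r`. -/
noncomputable def rowAdd {n N : ℕ} (A : Matrix (Fin n) (Fin N) ℝ) (i r : Fin n) (t : ℝ) :
    Matrix (Fin n) (Fin N) ℝ :=
  A.updateRow i (A i + t • A r)

theorem rowAdd_apply {n N : ℕ} (A : Matrix (Fin n) (Fin N) ℝ) (i r : Fin n) (t : ℝ) (r' : Fin n)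
    (j : Fin N) : rowAdd A i r t r' j = if r' = i then A i j + t * A r j else A r' j := by
  unfold rowAdd
  rw [updateRow_apply]
  simp

/-- A row operation is a multiplication from the left, so it can be charged to the left factor. This
keeps the factor `B` of `Reduces` up to date. -/
theorem rowAdd_mul {n m N : ℕ} (B : Matrix (Fin n) (Fin m) ℝ) (W : Matrix (Fin m) (Fin N) ℝ)
    (i r : Fin n) (t : ℝ) : rowAdd (B * W) i r t = rowAdd B i r t * W := by
  ext r' j
  rw [rowAdd_apply]
  split_ifs with h
  · subst h
    simp only [mul_apply, rowAdd_apply, if_true, Finset.mul_sum, ← Finset.sum_add_distrib]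
    exact Finset.sum_congr rfl fun _ _ => by ring
  · simp [mul_apply, rowAdd_apply, h]

/-- `A` arises from the matrix with columns `V j` by multiplication with a matrix of
determinant `1 / D`. -/
def Reduces {n N : ℕ} (V : Fin N → Fin n → ℝ) (A : Matrix (Fin n) (Fin N) ℝ) (D : ℝ) : Prop :=
  ∃ B : Matrix (Fin n) (Fin n) ℝ, A = B * (of V)ᵀ ∧ B.det * D = 1

variable {n N : ℕ} {V : Fin N → Fin n → ℝ} {A : Matrix (Fin n) (Fin N) ℝ} {D : ℝ}

theorem Reduces.rowAdd (h : Reduces V A D) {i r : Fin n} {t : ℝ} (hir : i ≠ r ∨ t = 0) :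
    Reduces V (rowAdd A i r t) D := by
  obtain ⟨B, rfl, hB⟩ := h
  refine ⟨_, rowAdd_mul B _ i r t, ?_⟩
  rcases hir with hir | rfl
  · rw [_root_.rowAdd, det_updateRow_add_smul_self _ hir, hB]
  · simp [_root_.rowAdd, hB]

/-- Adding `1 / p - 1` times a row to itself divides the row by `p`; so the one row operation also
serves to normalise pivots, and `D` collects their product. -/
theorem Reduces.scale (h : Reduces V A D) (i : Fin n) {p : ℝ} (hp : p ≠ 0) :
    Reduces V (_root_.rowAdd A i i (1 / p - 1)) (D * p) := by
  obtain ⟨B, rfl, hB⟩ := h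
  refine ⟨_, rowAdd_mul B _ i i _, ?_⟩
  have : B i + (1 / p - 1) • B i = (1 / p) • B i := by
    ext j; simp; ring
  rw [_root_.rowAdd, this, det_updateRow_smul, updateRow_eq_self]
  refine Eq.trans ?_ hB
  field_simp

theorem Reduces.submatrix {U : Fin n → Fin N} (h : Reduces V A D) :
    ∃ B : Matrix (Fin n) (Fin n) ℝ, A = B * (of V)ᵀ ∧ B.det * D = 1 ∧
      A.submatrix id U = B * columnMatrix V U := by
  obtain ⟨B, rfl, hB⟩ := h
  exact ⟨B, rfl, hB, by ext i j; simp [mul_apply, columnMatrix]⟩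

/-- The columns `U c'`, `c' < c`, of `A` are unit vectors. -/
def UnitColumns (A : Matrix (Fin n) (Fin N) ℝ) (U : Fin n → Fin N) (c : ℕ) : Prop :=
  ∀ c' : Fin n, (c' : ℕ) < c → ∀ r, A r (U c') = if r = c' then 1 else 0

/-- A row with index at least `c` vanishes in the finished columns, so adding multiples of it does
not disturb them. -/
theorem UnitColumns.rowAdd {U : Fin n → Fin N} {c : ℕ} (h : UnitColumns A U c) {i r : Fin n}
    {t : ℝ} (hr : c ≤ (r : ℕ) ∨ t = 0) : UnitColumns (rowAdd A i r t) U c := by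
  intro c' hc' r'
  rw [rowAdd_apply]
  split_ifs with h1 h2 h2
  · have hne : t * A r (U c') = 0 := by
      rcases hr with hr | rfl
      · rw [h c' hc' r, if_neg (by rintro rfl; omega), mul_zero]
      · simp
    rw [hne, h c' hc', if_pos (by rw [← h1, h2]), add_zero]
  · have hne : t * A r (U c') = 0 := by
      rcases hr with hr | rfl
      · rw [h c' hc' r, if_neg (by rintro rfl; omega), mul_zero]
      · simp
    rw [hne, h c' hc', if_neg (by rw [← h1]; exact h2), add_zero]
  · rw [h c' hc', if_pos h2]
  · rw [h c' hc', if_neg h2]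

/-- Without a nonzero entry from row `c` downwards, the column `U c` is a combination of the unit
columns before it. -/
theorem det_eq_zero_of_pivot {U : Fin n → Fin N} {c : Fin n} (h : Reduces V A D)
    (hu : UnitColumns A U c) (hz : ∀ r, c ≤ r → A r (U c) = 0) : (columnMatrix V U).det = 0 := by
  obtain ⟨B, -, hB, hM⟩ := h.submatrix (U := U)
  have hdet : (A.submatrix id U).det = 0 := by
    rw [← exists_mulVec_eq_zero_iff]
    -- The kernel vector expressing this dependence: the unit vector `c` minus the entries of column
    -- `U c` above row `c`.
    refine ⟨fun c' => if c' = c then 1 else if c' < c then - A c' (U c) else 0, ?_, ?_⟩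
    · intro h0
      simpa using congrFun h0 c
    · ext r
      simp only [mulVec, dotProduct, submatrix_apply, id, Pi.zero_apply]
      have : ∀ c', A r (U c') * (if c' = c then 1 else if c' < c then - A c' (U c) else 0) =
          (if c' = c then A r (U c) else 0) - (if c' = r then
            (if r < c then A r (U c) else 0) else 0) := by
        intro c'
        rcases lt_trichotomy c' c with h1 | rfl | h1
        · rw [if_neg h1.ne, if_pos h1, if_neg h1.ne, hu c' h1]
          by_cases h2 : r = c'
          · subst h2; simp [h1]
          · simp [h2, Ne.symm h2]
        · by_cases h2 : c' = r
          · subst h2; simp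
          · simp [h2]
        · rw [if_neg h1.ne', if_neg h1.not_gt, if_neg h1.ne']
          by_cases h2 : c' = r
          · subst h2; simp [h1.not_gt]
          · simp [h2]
      simp only [this, Finset.sum_sub_distrib, Finset.sum_ite_eq', Finset.mem_univ, if_true]
      split_ifs with h1
      · simp
      · simp [hz r (not_lt.1 h1)]
  rw [hM, det_mul] at hdet
  rcases mul_eq_zero.1 hdet with h0 | h0
  · simp [h0] at hB
  · exact h0

/-- The state of the elimination after `c` columns: the determinant is known to vanish, or the
first `c` columns are reduced. -/
def Eliminated (V : Fin N → Fin n → ℝ) (U : Fin n → Fin N) (c : ℕ)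
    (A : Matrix (Fin n) (Fin N) ℝ) (D : ℝ) : Prop :=
  (D = 0 ∧ (columnMatrix V U).det = 0) ∨ (Reduces V A D ∧ UnitColumns A U c)

/-- `Eliminated`, and the pivot in column `U c` vanishes only if the entries below it do, as far
as row `R`. -/
def PivotSearched (V : Fin N → Fin n → ℝ) (U : Fin n → Fin N) (c : Fin n) (R : ℕ)
    (A : Matrix (Fin n) (Fin N) ℝ) (D : ℝ) : Prop :=
  (D = 0 ∧ (columnMatrix V U).det = 0) ∨ (Reduces V A D ∧ UnitColumns A U c ∧
    (A c (U c) = 0 → ∀ r : Fin n, c < r → (r : ℕ) < R → A r (U c) = 0))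

/-- `Eliminated`, the pivot in column `U c` is `1`, and the other entries vanish up to row `R`. -/
def ColumnCleared (V : Fin N → Fin n → ℝ) (U : Fin n → Fin N) (c : Fin n) (R : ℕ)
    (A : Matrix (Fin n) (Fin N) ℝ) (D : ℝ) : Prop :=
  (D = 0 ∧ (columnMatrix V U).det = 0) ∨ (Reduces V A D ∧ UnitColumns A U c ∧
    A c (U c) = 1 ∧ ∀ r : Fin n, r ≠ c → (r : ℕ) < R → A r (U c) = 0)

theorem eliminated_zero {U : Fin n → Fin N} : Eliminated V U 0 (of V)ᵀ 1 :=
  Or.inr ⟨⟨1, by simp, by simp⟩, fun _ h => absurd h (Nat.not_lt_zero _)⟩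

theorem Eliminated.pivotSearched {U : Fin n → Fin N} {c : Fin n} (h : Eliminated V U c A D) :
    PivotSearched V U c 0 A D :=
  h.imp_right fun h => ⟨h.1, h.2, fun _ _ _ h => absurd h (Nat.not_lt_zero _)⟩

/-- A lower row is added to the pivot row instead of being exchanged with it, which leaves the
determinant alone and needs no record of signs. If the new pivot is still zero, so is the entry in
row `r`. -/
theorem PivotSearched.step {U : Fin n → Fin N} {c r : Fin n} (h : PivotSearched V U c r A D) :
    PivotSearched V U c (r + 1)
      (rowAdd A c r (if c < r ∧ A c (U c) = 0 then 1 else 0)) D := by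
  refine h.imp_right fun ⟨h1, h2, h3⟩ => ?_
  by_cases hc : c < r ∧ A c (U c) = 0
  · rw [if_pos hc]
    refine ⟨h1.rowAdd (Or.inl hc.1.ne), h2.rowAdd (Or.inl hc.1.le), fun h4 r' hr' hr'' => ?_⟩
    rw [rowAdd_apply, if_pos rfl, hc.2, zero_add, one_mul] at h4
    rw [rowAdd_apply, if_neg hr'.ne']
    rcases Nat.lt_succ_iff_lt_or_eq.1 hr'' with h5 | h5
    · exact h3 hc.2 r' hr' h5
    · rw [Fin.ext h5, h4]
  · rw [if_neg hc]
    have : rowAdd A c r 0 = A := by simp [rowAdd]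
    rw [this]
    refine ⟨h1, h2, fun h4 r' hr' hr'' => ?_⟩
    rcases Nat.lt_succ_iff_lt_or_eq.1 hr'' with h5 | h5
    · exact h3 h4 r' hr' h5
    · rw [← Fin.ext h5] at hc; exact absurd ⟨hr', h4⟩ hc

/-- If the pivot is zero after a full search, multiplying `D` by it records the singular case for
good. The row operation with the junk value `1 / 0` is then harmless, because nothing is claimed
about the matrix any more. -/
theorem PivotSearched.scale {U : Fin n → Fin N} {c : Fin n} (h : PivotSearched V U c n A D) :
    ColumnCleared V U c 0 (rowAdd A c c (1 / A c (U c) - 1)) (D * A c (U c)) := by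
  rcases h with ⟨h1, h2⟩ | ⟨h1, h2, h3⟩
  · exact Or.inl ⟨by simp [h1], h2⟩
  · by_cases hp : A c (U c) = 0
    · refine Or.inl ⟨by simp [hp], det_eq_zero_of_pivot h1 h2 fun r hr => ?_⟩
      rcases hr.eq_or_lt with rfl | hr
      · exact hp
      · exact h3 hp r hr r.2
    · refine Or.inr ⟨h1.scale c hp, h2.rowAdd (Or.inl le_rfl), ?_,
        fun _ _ h => absurd h (Nat.not_lt_zero _)⟩
      rw [rowAdd_apply, if_pos rfl]
      field_simp
      ring

theorem ColumnCleared.step {U : Fin n → Fin N} {c r : Fin n} (h : ColumnCleared V U c r A D) :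
    ColumnCleared V U c (r + 1) (rowAdd A r c (if r = c then 0 else - A r (U c))) D := by
  refine h.imp_right fun ⟨h1, h2, h3, h4⟩ => ?_
  by_cases hc : r = c
  · rw [if_pos hc]
    have : rowAdd A r c 0 = A := by simp [rowAdd]
    rw [this]
    refine ⟨h1, h2, h3, fun r' hr' hr'' => ?_⟩
    rcases Nat.lt_succ_iff_lt_or_eq.1 hr'' with h5 | h5
    · exact h4 r' hr' h5
    · exact absurd ((Fin.ext h5).trans hc) hr'
  · rw [if_neg hc]
    refine ⟨h1.rowAdd (Or.inl hc), h2.rowAdd (Or.inl le_rfl), ?_, fun r' hr' hr'' => ?_⟩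
    · rw [rowAdd_apply, if_neg (Ne.symm hc), h3]
    · rw [rowAdd_apply]
      split_ifs with h5
      · rw [h3]; ring
      · rcases Nat.lt_succ_iff_lt_or_eq.1 hr'' with h6 | h6
        · exact h4 r' hr' h6
        · exact absurd (Fin.ext h6) h5

theorem ColumnCleared.eliminated {U : Fin n → Fin N} {c : Fin n} (h : ColumnCleared V U c n A D) :
    Eliminated V U (c + 1) A D := by
  refine h.imp_right fun ⟨h1, h2, h3, h4⟩ => ⟨h1, fun c' hc' r => ?_⟩
  rcases Nat.lt_succ_iff_lt_or_eq.1 hc' with h5 | h5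
  · exact h2 c' h5 r
  · rw [Fin.ext h5]
    split_ifs with h6
    · rw [h6, h3]
    · exact h4 r h6 r.2

/-- When all `n` columns are unit vectors, the accumulated factor `B` is the inverse of the basis
matrix. -/
theorem Eliminated.det_eq {U : Fin n → Fin N} (h : Eliminated V U n A D) :
    D = (columnMatrix V U).det ∧ ((columnMatrix V U).det ≠ 0 →
      ∀ c j, A c j = ((columnMatrix V U)⁻¹ *ᵥ V j) c) := by
  rcases h with ⟨h1, h2⟩ | ⟨h1, h2⟩
  · exact ⟨by rw [h1, h2], fun h => absurd h2 h⟩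
  · obtain ⟨B, hA, hB, hM⟩ := h1.submatrix (U := U)
    have h3 : A.submatrix id U = 1 := by
      ext r c
      rw [submatrix_apply, id, h2 c c.2, one_apply]
    rw [h3] at hM
    have h4 : B.det * (columnMatrix V U).det = 1 := by rw [← det_mul, ← hM, det_one]
    refine ⟨?_, fun _ c j => ?_⟩
    · have : B.det ≠ 0 := left_ne_zero_of_mul_eq_one hB
      exact mul_left_cancel₀ this (hB.trans h4.symm)
    · rw [inv_eq_left_inv hM.symm, hA]
      simp [mul_apply, mulVec, dotProduct]

end

/-! ### Linear programming duality and simplicial cones -/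

section

open Matrix Filter Topology

theorem columnMatrix_mulVec {n N : ℕ} (V : Fin N → Fin n → ℝ) (U : Fin n → Fin N)
    (w : Fin n → ℝ) : columnMatrix V U *ᵥ w = ∑ i, w i • V (U i) := by
  ext r
  simp [mulVec, dotProduct, columnMatrix, mul_comm]

theorem vecMul_columnMatrix {n N : ℕ} (V : Fin N → Fin n → ℝ) (U : Fin n → Fin N)
    (a : Fin n → ℝ) (i : Fin n) : (a ᵥ* columnMatrix V U) i = a ⬝ᵥ V (U i) := by
  simp [vecMul, dotProduct, columnMatrix]

theorem det_columnMatrix_ne_zero {n N : ℕ} {V : Fin N → Fin n → ℝ} {U : Fin n → Fin N} :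
    (columnMatrix V U).det ≠ 0 ↔ LinearIndependent ℝ fun i => V (U i) := by
  rw [← isUnit_iff_ne_zero, ← isUnit_iff_isUnit_det, ← linearIndependent_cols_iff_isUnit]
  rfl

/-- With costs `c`, the basis `U` is dual feasible and no further constraint is active. -/
def DualFeasible {n N : ℕ} (V : Fin N → Fin n → ℝ) (c : Fin N → ℝ) (U : Fin n → Fin N) : Prop :=
  ∃ a : Fin n → ℝ, (∀ i, a ⬝ᵥ V (U i) = c (U i)) ∧ ∀ j, j ∉ Set.range U → a ⬝ᵥ V j < c j

/-- The costs `c` are in general position. -/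
def GenericCosts {n N : ℕ} (V : Fin N → Fin n → ℝ) (c : Fin N → ℝ) : Prop :=
  ∀ U : Fin n → Fin N, StrictMono U → (columnMatrix V U).det ≠ 0 →
    ∀ a : Fin n → ℝ, (∀ i, a ⬝ᵥ V (U i) = c (U i)) → ∀ j, j ∉ Set.range U → a ⬝ᵥ V j ≠ c j

/-- A spanning family contains a basis; listing its indices in increasing order makes the family `U`
a canonical name of the index set. -/
theorem exists_strictMono_basis {n N : ℕ} {V : Fin N → Fin n → ℝ} {J : Set (Fin N)}
    (hJ : Submodule.span ℝ (V '' J) = ⊤) :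
    ∃ U : Fin n → Fin N, StrictMono U ∧ (∀ i, U i ∈ J) ∧ (columnMatrix V U).det ≠ 0 := by
  obtain ⟨κ, f, hf, hspan, hli⟩ := exists_linearIndependent' ℝ (fun j : J => V j)
  have hr : Set.range (fun j : J => V j) = V '' J := by
    ext x; simp
  rw [hr, hJ] at hspan
  have : Finite κ := Finite.of_injective f hf
  have := Fintype.ofFinite κ
  let b : Module.Basis κ ℝ (Fin n → ℝ) := Module.Basis.mk hli hspan.ge
  have hcard : Fintype.card κ = n := by
    have := Module.finrank_eq_card_basis b
    simpa using this.symm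
  classical
  let g : κ → Fin N := fun x => (f x : Fin N)
  have hg : Function.Injective g := Subtype.val_injective.comp hf
  let s : Finset (Fin N) := Finset.univ.image g
  have hs : s.card = n := by
    rw [Finset.card_image_of_injective _ hg, Finset.card_univ, hcard]
  refine ⟨s.orderEmbOfFin hs, (s.orderEmbOfFin hs).strictMono, fun i => ?_, ?_⟩
  · have := s.orderEmbOfFin_mem hs i
    obtain ⟨x, -, hx⟩ := Finset.mem_image.1 this
    rw [← hx]
    exact (f x).2
  · rw [det_columnMatrix_ne_zero]
    have hm : ∀ i, ∃ x, g x = s.orderEmbOfFin hs i := fun i => by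
      obtain ⟨x, -, hx⟩ := Finset.mem_image.1 (s.orderEmbOfFin_mem hs i)
      exact ⟨x, hx⟩
    choose h hh using hm
    have hinj : Function.Injective h := fun i i' hi => (s.orderEmbOfFin hs).injective (by
      rw [← hh, ← hh, hi])
    have h2 := hli.comp h hinj
    have h3 : (fun i => V (s.orderEmbOfFin hs i)) = ((fun j : J => V j) ∘ f) ∘ h := by
      funext i
      rw [← hh i]
      rfl
    rw [h3]
    exact h2

/-- A ball around the origin lies in the polytope, and a feasible `a` is bounded on the polytope by
one constant. Testing `a` at small multiples of the unit vectors bounds its coordinates. -/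
theorem isBounded_dual {n N : ℕ} {V : Fin N → Fin n → ℝ} (h0 : 0 ∈ interior (vPolytope V))
    (c : Fin N → ℝ) : Bornology.IsBounded {a : Fin n → ℝ | ∀ j, a ⬝ᵥ V j ≤ c j} := by
  obtain ⟨r, hr, hball⟩ := Metric.mem_nhds_iff.1 (mem_interior_iff_mem_nhds.1 h0)
  let C : ℝ := ∑ j, |c j|
  have hC : ∀ a : Fin n → ℝ, (∀ j, a ⬝ᵥ V j ≤ c j) → ∀ x ∈ vPolytope V, a ⬝ᵥ x ≤ C := by
    intro a ha x hx
    have hconv : Convex ℝ {x : Fin n → ℝ | a ⬝ᵥ x ≤ C} := by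
      have : IsLinearMap ℝ fun x : Fin n → ℝ => a ⬝ᵥ x :=
        ⟨fun x y => dotProduct_add _ _ _, fun t x => dotProduct_smul _ _ _⟩
      exact convex_halfSpace_le this C
    refine convexHull_min ?_ hconv hx
    rintro _ ⟨j, rfl⟩
    exact (ha j).trans ((le_abs_self _).trans
      (Finset.single_le_sum (f := fun j => |c j|) (fun _ _ => abs_nonneg _) (Finset.mem_univ j)))
  refine (Metric.isBounded_closedBall (x := (0 : Fin n → ℝ)) (r := |C| * (2 / r))).subset ?_
  intro a ha
  rw [mem_closedBall_zero_iff, pi_norm_le_iff_of_nonneg (by positivity)]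
  intro i
  -- The sign `σ` treats the upper and the lower bound of a coordinate together.
  have key : ∀ σ : ℝ, |σ| = 1 → σ * a i ≤ |C| * (2 / r) := by
    intro σ hσ
    have hx : Pi.single i (σ * (r / 2)) ∈ vPolytope V := by
      apply hball
      rw [mem_ball_zero_iff, pi_norm_lt_iff hr]
      intro i'
      by_cases h : i' = i
      · subst h
        simp only [Pi.single_eq_same, norm_mul, Real.norm_eq_abs, hσ, one_mul]
        rw [abs_of_pos (by positivity)]
        linarith
      · simpa [Pi.single_eq_of_ne h] using hr
    have h1 := hC a ha _ hx
    rw [dotProduct_single] at h1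
    have h2 : σ * a i * (r / 2) ≤ |C| := by
      calc σ * a i * (r / 2) = a i * (σ * (r / 2)) := by ring
        _ ≤ C := h1
        _ ≤ |C| := le_abs_self _
    calc σ * a i = σ * a i * (r / 2) * (2 / r) := by field_simp
      _ ≤ _ := mul_le_mul_of_nonneg_right h2 (by positivity)
  rw [Real.norm_eq_abs, abs_le]
  have h1 := key 1 (by simp)
  have h2 := key (-1) (by simp)
  constructor <;> linarith

/-- The basis is the set of active constraints at an optimal vertex for the objective `x`. The
weights are nonnegative since otherwise a feasible direction would improve the objective. -/
theorem exists_dualFeasible {n N : ℕ} {V : Fin N → Fin n → ℝ} (h0 : 0 ∈ interior (vPolytope V))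
    {c : Fin N → ℝ} (hc : ∀ j, 0 < c j) (hgen : GenericCosts V c) (x : Fin n → ℝ) :
    ∃ U : Fin n → Fin N, StrictMono U ∧ (columnMatrix V U).det ≠ 0 ∧ DualFeasible V c U ∧
      ∃ w : Fin n → ℝ, (∀ i, 0 ≤ w i) ∧ x = ∑ i, w i • V (U i) := by
  set D : Set (Fin n → ℝ) := {a | ∀ j, a ⬝ᵥ V j ≤ c j} with hD
  have hcont : ∀ y : Fin n → ℝ, Continuous fun a : Fin n → ℝ => a ⬝ᵥ y := fun y => by
    unfold dotProduct; fun_prop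
  have hclosed : IsClosed D := by
    rw [hD, Set.ofPred_forall]
    exact isClosed_iInter fun j => isClosed_le (hcont _) continuous_const
  have hcomp : IsCompact D := Metric.isCompact_of_isClosed_isBounded hclosed (isBounded_dual h0 c)
  have hne : D.Nonempty := ⟨0, fun j => by simpa using (hc j).le⟩
  obtain ⟨a₀, ha₀, hmax⟩ := hcomp.exists_isMaxOn hne (hcont x).continuousOn
  -- An optimal point need not be a vertex, so an extreme point of the optimal face `E` is chosen.
  set E : Set (Fin n → ℝ) := D ∩ {a | a ⬝ᵥ x = a₀ ⬝ᵥ x} with hE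
  have hEcomp : IsCompact E := hcomp.inter_right (isClosed_eq (hcont x) continuous_const)
  obtain ⟨a, haE, hext⟩ := hEcomp.extremePoints_nonempty ⟨a₀, ha₀, rfl⟩
  have hax : ∀ b ∈ D, b ⬝ᵥ x ≤ a ⬝ᵥ x := fun b hb => by
    rw [show a ⬝ᵥ x = a₀ ⬝ᵥ x from haE.2]; exact hmax hb
  -- A direction that does not increase any active constraint is feasible for a short while: the
  -- inactive ones have room to spare.
  have hmove : ∀ d : Fin n → ℝ, (∀ j, a ⬝ᵥ V j = c j → d ⬝ᵥ V j ≤ 0) →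
      ∀ᶠ t in 𝓝[>] (0 : ℝ), a + t • d ∈ D := by
    intro d hd
    rw [hD]
    simp only [Set.mem_ofPred_eq]
    refine eventually_all.2 fun j => ?_
    rcases (haE.1 j).eq_or_lt with h | h
    · filter_upwards [self_mem_nhdsWithin] with t ht
      rw [add_dotProduct, smul_dotProduct, smul_eq_mul]
      have := mul_nonpos_of_nonneg_of_nonpos (le_of_lt ht) (hd j h)
      linarith
    · have hct : Continuous fun t : ℝ => (a + t • d) ⬝ᵥ V j := by
        simp only [add_dotProduct, smul_dotProduct]; fun_prop
      have := hct.tendsto 0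
      simp only [zero_smul, add_zero] at this
      exact ((this.eventually (gt_mem_nhds h)).mono fun t ht => ht.le).filter_mono
        nhdsWithin_le_nhds
  -- If the active points did not span, some `d ≠ 0` would be orthogonal to all of them. Then `a ± t
  -- • d` would be feasible, hence optimal by maximality in both directions, contrary to extremality
  -- in `E`.
  have hspan : Submodule.span ℝ (V '' {j | a ⬝ᵥ V j = c j}) = ⊤ := by
    by_contra hne
    obtain ⟨f, hf, hker⟩ := Submodule.exists_le_ker_of_lt_top _ (lt_top_iff_ne_top.2 hne)
    obtain ⟨d, hd⟩ : ∃ d : Fin n → ℝ, ∀ y, f y = d ⬝ᵥ y := by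
      refine ⟨fun i => f (Pi.single i 1), fun y => ?_⟩
      conv_lhs => rw [← Finset.univ_sum_single y]
      rw [map_sum]
      refine Finset.sum_congr rfl fun i _ => ?_
      have : Pi.single i (y i) = y i • Pi.single (M := fun _ => ℝ) i 1 := by
        rw [← Pi.single_smul]; simp
      rw [this, map_smul, smul_eq_mul, mul_comm]
    have hdJ : ∀ j, a ⬝ᵥ V j = c j → d ⬝ᵥ V j = 0 := fun j hj => by
      rw [← hd]
      exact hker (Submodule.subset_span ⟨j, hj, rfl⟩)
    obtain ⟨t, ⟨h1, h2⟩, ht⟩ := (((hmove d fun j hj => (hdJ j hj).le).and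
      (hmove (-d) fun j hj => by rw [neg_dotProduct, hdJ j hj, neg_zero])).and
        self_mem_nhdsWithin).exists
    have ht' : (0 : ℝ) < t := ht
    have h3 := hax _ h1
    have h4 := hax _ h2
    simp only [add_dotProduct, smul_dotProduct, neg_dotProduct, smul_eq_mul] at h3 h4
    have h5 : t * d ⬝ᵥ x = 0 := by linarith
    have h6 : a + t • d ∈ E := ⟨h1, by
      simp only [Set.mem_ofPred_eq, add_dotProduct, smul_dotProduct, smul_eq_mul]
      rw [h5, add_zero]; exact haE.2⟩
    have h7 : a + t • -d ∈ E := ⟨h2, by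
      simp only [Set.mem_ofPred_eq, add_dotProduct, smul_dotProduct, smul_eq_mul, neg_dotProduct]
      rw [mul_neg, h5, neg_zero, add_zero]; exact haE.2⟩
    have h8 := hext h6 h7 ⟨1 / 2, 1 / 2, by norm_num, by norm_num, by norm_num, by
      ext i; simp; ring⟩
    have h9 : d = 0 := by
      have : t • d = 0 := by simpa using h8
      exact (smul_eq_zero.1 this).resolve_left ht'.ne'
    exact hf (LinearMap.ext fun y => by rw [hd, h9]; simp)
  obtain ⟨U, hU, hUJ, hdet⟩ := exists_strictMono_basis hspan
  have hstrict : ∀ j, j ∉ Set.range U → a ⬝ᵥ V j < c j := fun j hj =>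
    lt_of_le_of_ne (haE.1 j) (hgen U hU hdet a hUJ j hj)
  refine ⟨U, hU, hdet, ⟨a, hUJ, hstrict⟩, (columnMatrix V U)⁻¹ *ᵥ x, fun i => ?_, ?_⟩
  · by_contra hneg
    push Not at hneg
    -- Moving along `d` relaxes the `i`-th active constraint and keeps the others tight; the
    -- objective changes at the rate of minus the `i`-th weight.
    let d : Fin n → ℝ := - ((columnMatrix V U)⁻¹ i)
    have hinv : (columnMatrix V U)⁻¹ * columnMatrix V U = 1 :=
      nonsing_inv_mul _ (isUnit_iff_ne_zero.2 hdet)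
    have hd : ∀ j, a ⬝ᵥ V j = c j → d ⬝ᵥ V j ≤ 0 := by
      intro j hj
      by_cases hjU : j ∈ Set.range U
      · obtain ⟨i', rfl⟩ := hjU
        have : d ⬝ᵥ V (U i') = - ((columnMatrix V U)⁻¹ * columnMatrix V U) i i' := by
          simp only [d, neg_dotProduct]
          rfl
        rw [this, hinv, one_apply]
        split_ifs <;> simp
      · exact absurd hj (hstrict j hjU).ne
    obtain ⟨t, h1, ht⟩ := ((hmove d hd).and self_mem_nhdsWithin).exists
    have ht' : (0 : ℝ) < t := ht
    have h3 := hax _ h1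
    simp only [add_dotProduct, smul_dotProduct, d, neg_dotProduct, smul_eq_mul] at h3
    have h4 : 0 < t * -((columnMatrix V U)⁻¹ i ⬝ᵥ x) := mul_pos ht' (neg_pos.2 hneg)
    linarith
  · rw [← columnMatrix_mulVec, mulVec_mulVec, mul_nonsing_inv _ (isUnit_iff_ne_zero.2 hdet),
      one_mulVec]

/-- The points of a simplicial cone are the vectors with nonnegative coordinates. -/
theorem mem_coneSimplex_iff {n N : ℕ} {V : Fin N → Fin n → ℝ} {U : Fin n → Fin N}
    {x : Fin n → ℝ} : x ∈ coneSimplex V U ↔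
      ∃ w : Fin n → ℝ, (∀ i, 0 ≤ w i) ∧ ∑ i, w i ≤ 1 ∧ x = ∑ i, w i • V (U i) := by
  constructor
  · intro hx
    refine convexHull_min (t := {x | ∃ w : Fin n → ℝ, (∀ i, 0 ≤ w i) ∧ ∑ i, w i ≤ 1 ∧
      x = ∑ i, w i • V (U i)}) ?_ ?_ hx
    · rintro y (rfl | ⟨i, rfl⟩)
      · exact ⟨0, by simp, by simp, by simp⟩
      · refine ⟨Pi.single i 1, fun i' => ?_, by simp, ?_⟩
        · by_cases h : i' = i
          · subst h; simp
          · simp [Pi.single_eq_of_ne h]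
        · simp [Pi.single_apply, ite_smul]
    · rintro _ ⟨w, hw, hw1, rfl⟩ _ ⟨w', hw', hw1', rfl⟩ p q hp hq hpq
      refine ⟨p • w + q • w', fun i => ?_, ?_, ?_⟩
      · simp only [Pi.add_apply, Pi.smul_apply, smul_eq_mul]
        have := hw i; have := hw' i
        positivity
      · simp only [Pi.add_apply, Pi.smul_apply, smul_eq_mul, Finset.sum_add_distrib,
          ← Finset.mul_sum]
        nlinarith
      · simp only [Pi.add_apply, Pi.smul_apply, smul_eq_mul, add_smul, Finset.sum_add_distrib,
          Finset.smul_sum, smul_smul]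
  · rintro ⟨w, hw, hw1, rfl⟩
    -- The index `none` stands for the vertex at the origin, which takes up the weight missing from
    -- `1`.
    let f : Option (Fin n) → (Fin n → ℝ) := fun o => o.elim 0 fun i => V (U i)
    let g : Option (Fin n) → ℝ := fun o => o.elim (1 - ∑ i, w i) w
    have h := (convex_convexHull ℝ (insert 0 (Set.range fun i => V (U i)))).sum_mem
      (t := Finset.univ) (w := g) (z := f) (by
        rintro (_ | i) -
        · simpa [g] using hw1
        · exact hw i) (by simp [g, Fintype.sum_option]) (by
        rintro (_ | i) -
        · exact subset_convexHull _ _ (Or.inl rfl)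
        · exact subset_convexHull _ _ (Or.inr ⟨i, rfl⟩))
    unfold coneSimplex
    simpa [Fintype.sum_option, f, g] using h

/-- If the `i`-th coordinate were zero, a small step by a negative multiple of `V (U i)` would stay
in the simplex and yet make this coordinate negative; coordinates are unique as the determinant is
nonzero. -/
theorem pos_of_mem_interior_coneSimplex {n N : ℕ} {V : Fin N → Fin n → ℝ} {U : Fin n → Fin N}
    (hdet : (columnMatrix V U).det ≠ 0) {x : Fin n → ℝ} (hx : x ∈ interior (coneSimplex V U)) :
    ∃ w : Fin n → ℝ, (∀ i, 0 < w i) ∧ x = ∑ i, w i • V (U i) := by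
  obtain ⟨w, hw, -, hxw⟩ := mem_coneSimplex_iff.1 (interior_subset hx)
  refine ⟨w, fun i => lt_of_le_of_ne (hw i) fun hi => ?_, hxw⟩
  have hct : Continuous fun t : ℝ => x - t • V (U i) := by fun_prop
  have h1 := hct.tendsto 0
  simp only [zero_smul, sub_zero] at h1
  have h2 := (h1.eventually (mem_interior_iff_mem_nhds.1 hx)).filter_mono
    (nhdsWithin_le_nhds (s := Set.Ioi 0))
  obtain ⟨t, h3, ht⟩ := (h2.and self_mem_nhdsWithin).exists
  have ht' : (0 : ℝ) < t := ht
  obtain ⟨w', hw', -, hxw'⟩ := mem_coneSimplex_iff.1 h3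
  have h4 : columnMatrix V U *ᵥ (w - t • Pi.single i 1) = columnMatrix V U *ᵥ w' := by
    rw [mulVec_sub, mulVec_smul, columnMatrix_mulVec, columnMatrix_mulVec, columnMatrix_mulVec,
      ← hxw, ← hxw']
    simp [Pi.single_apply, ite_smul]
  have h5 := mulVec_injective_iff_isUnit.2
    ((isUnit_iff_isUnit_det _).2 (isUnit_iff_ne_zero.2 hdet)) h4
  have h6 := congrFun h5 i
  simp only [Pi.sub_apply, Pi.smul_apply, Pi.single_eq_same, smul_eq_mul, mul_one, ← hi] at h6
  have := hw' i
  linarith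

/-- Write a common interior point in both bases and compare the costs of the two representations.
The normal `a` of `U` is tight on `U` but strictly slack somewhere on `U'`, where the weights are
positive, so `U` is strictly cheaper. By symmetry so is `U'`. -/
theorem disjoint_interior_coneSimplex {n N : ℕ} {V : Fin N → Fin n → ℝ} {c : Fin N → ℝ}
    {U U' : Fin n → Fin N} (hU : StrictMono U) (hU' : StrictMono U') (hne : U ≠ U')
    (hdet : (columnMatrix V U).det ≠ 0) (hdet' : (columnMatrix V U').det ≠ 0)
    (hf : DualFeasible V c U) (hf' : DualFeasible V c U') :
    Disjoint (interior (coneSimplex V U)) (interior (coneSimplex V U')) := by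
  rw [Set.disjoint_left]
  intro x hx hx'
  obtain ⟨w, hw, hxw⟩ := pos_of_mem_interior_coneSimplex hdet hx
  obtain ⟨w', hw', hxw'⟩ := pos_of_mem_interior_coneSimplex hdet' hx'
  have key : ∀ {U U' : Fin n → Fin N} {w w' : Fin n → ℝ}, StrictMono U → StrictMono U' →
      U ≠ U' → DualFeasible V c U → (∀ i, 0 < w' i) → x = ∑ i, w i • V (U i) →
      x = ∑ i, w' i • V (U' i) → ∑ i, w i * c (U i) < ∑ i, w' i * c (U' i) := by
    intro U U' w w' hU hU' hne ⟨a, ha, ha'⟩ hw' hxw hxw'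
    have h1 : a ⬝ᵥ x = ∑ i, w i * c (U i) := by
      rw [hxw, dotProduct_sum]
      simp [dotProduct_smul, ha]
    have h2 : a ⬝ᵥ x = ∑ i, w' i * (a ⬝ᵥ V (U' i)) := by
      rw [hxw', dotProduct_sum]
      simp [dotProduct_smul]
    rw [← h1, h2]
    have hle : ∀ j, a ⬝ᵥ V j ≤ c j := fun j => by
      by_cases hj : j ∈ Set.range U
      · obtain ⟨i, rfl⟩ := hj
        exact (ha i).le
      · exact (ha' j hj).le
    -- Otherwise the ranges would coincide by cardinality, and increasing families with equal ranges
    -- are equal.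
    obtain ⟨i₀, hi₀⟩ : ∃ i, U' i ∉ Set.range U := by
      by_contra hall
      push Not at hall
      have hsub : Finset.univ.image U' ⊆ Finset.univ.image U := by
        intro j hj
        obtain ⟨i, -, rfl⟩ := Finset.mem_image.1 hj
        obtain ⟨i', hi'⟩ := hall i
        exact Finset.mem_image.2 ⟨i', Finset.mem_univ _, hi'⟩
      have heq := Finset.eq_of_subset_of_card_le hsub (by
        rw [Finset.card_image_of_injective _ hU.injective,
          Finset.card_image_of_injective _ hU'.injective])
      apply hne
      rw [← hU.range_inj hU']
      simpa using congrArg (fun s : Finset (Fin N) => (s : Set (Fin N))) heq.symm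
    exact Finset.sum_lt_sum (fun i _ => mul_le_mul_of_nonneg_left (hle _) (hw' i).le)
      ⟨i₀, Finset.mem_univ _, mul_lt_mul_of_pos_left (ha' _ hi₀) (hw' _)⟩
  exact lt_asymm (key hU hU' hne hf hw' hxw hxw') (key hU' hU hne.symm hf' hw hxw' hxw)

theorem coneSimplex_subset {n N : ℕ} {V : Fin N → Fin n → ℝ} (h0 : 0 ∈ vPolytope V)
    (U : Fin n → Fin N) : coneSimplex V U ⊆ vPolytope V := by
  refine convexHull_min ?_ (convex_convexHull _ _)
  rintro y (rfl | ⟨i, rfl⟩)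
  · exact h0
  · exact subset_convexHull _ _ ⟨_, rfl⟩

theorem dotProduct_le_of_mem_vPolytope {n N : ℕ} {V : Fin N → Fin n → ℝ} {a : Fin n → ℝ} {b : ℝ}
    (h : ∀ j, a ⬝ᵥ V j ≤ b) {x : Fin n → ℝ} (hx : x ∈ vPolytope V) : a ⬝ᵥ x ≤ b := by
  have : IsLinearMap ℝ fun x : Fin n → ℝ => a ⬝ᵥ x :=
    ⟨fun x y => dotProduct_add _ _ _, fun t x => dotProduct_smul _ _ _⟩
  refine convexHull_min (t := {x | a ⬝ᵥ x ≤ b}) ?_ (convex_halfSpace_le this b) hx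
  rintro _ ⟨j, rfl⟩
  exact h j

end

/-! ### Volumes of simplices -/

section

open Matrix MeasureTheory

/-- The corner of the cube that is cut off by `∑ i, x i ≤ 1`. -/
def cornerSimplex (n : ℕ) : Set (Fin n → ℝ) := {x | (∀ i, 0 ≤ x i) ∧ ∑ i, x i ≤ 1}

theorem volume_coordinate_hyperplanes (n : ℕ) :
    volume {x : Fin n → ℝ | ∃ i, x i = 0} = 0 := by
  have : {x : Fin n → ℝ | ∃ i, x i = 0} = ⋃ i, {x | x i = 0} := by ext; simp
  rw [this, measure_iUnion_null_iff]
  intro i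
  rw [volume_pi]
  exact Measure.pi_hyperplane _ i 0

theorem measurableSet_openCorner (n : ℕ) (e : Fin n → ℝ) :
    MeasurableSet {x : Fin n → ℝ | (∀ i, 0 < e i * x i) ∧ ∑ i, e i * x i ≤ 1} := by
  have h1 : MeasurableSet {x : Fin n → ℝ | ∑ i, e i * x i ≤ 1} :=
    measurableSet_le (by fun_prop) measurable_const
  have h2 : MeasurableSet (⋂ i, {x : Fin n → ℝ | 0 < e i * x i}) :=
    MeasurableSet.iInter fun i => measurableSet_lt measurable_const (by fun_prop)
  convert h2.inter h1 using 1
  ext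
  simp

/-- The `ℓ¹` unit ball has volume `2 ^ n / n!`. Up to the coordinate hyperplanes it is the disjoint
union of `2 ^ n` open-orthant pieces, one for each sign pattern, and reflections carry them into
each other. -/
theorem volume_cornerSimplex {n : ℕ} (hn : 1 ≤ n) :
    volume (cornerSimplex n) = ENNReal.ofReal (1 / n.factorial) := by
  have : Nonempty (Fin n) := ⟨⟨0, hn⟩⟩
  let e : (Fin n → Bool) → Fin n → ℝ := fun s i => if s i then 1 else -1
  have he : ∀ s i, e s i * e s i = 1 := fun s i => by dsimp only [e]; split_ifs <;> norm_num
  have he1 : ∀ s i, |e s i| = 1 := fun s i => by dsimp only [e]; split_ifs <;> norm_num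
  let O : (Fin n → Bool) → Set (Fin n → ℝ) := fun s =>
    {x | (∀ i, 0 < e s i * x i) ∧ ∑ i, e s i * x i ≤ 1}
  have hball : volume {x : Fin n → ℝ | ∑ i, |x i| ≤ 1} = ENNReal.ofReal (2 ^ n / n.factorial) := by
    have h := volume_sum_rpow_le (Fin n) (p := 1) le_rfl 1
    simp only [Real.rpow_one, div_one, ENNReal.ofReal_one, one_pow, one_mul, Fintype.card_fin] at h
    rw [h]
    congr 2
    · rw [show (1 : ℝ) + 1 = ((1 : ℕ) : ℝ) + 1 by norm_num, Real.Gamma_nat_eq_factorial]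
      norm_num
    · exact Real.Gamma_nat_eq_factorial n
  have hunion : volume {x : Fin n → ℝ | ∑ i, |x i| ≤ 1} = volume (⋃ s, O s) := by
    refine measure_congr ?_
    have hnull := measure_eq_zero_iff_ae_notMem.1 (volume_coordinate_hyperplanes n)
    filter_upwards [hnull] with x hx
    have hx' : ∀ i, x i ≠ 0 := fun i hi => hx ⟨i, hi⟩
    apply propext
    change (∑ i, |x i| ≤ 1) ↔ x ∈ ⋃ s, O s
    rw [Set.mem_iUnion]
    constructor
    · intro h
      refine ⟨fun i => decide (0 < x i), ?_⟩
      have h2 : ∀ i, e (fun i => decide (0 < x i)) i * x i = |x i| := by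
        intro i
        rcases (hx' i).lt_or_gt with h | h
        · simp [e, h.not_gt, abs_of_neg h]
        · simp [e, h, abs_of_pos h]
      refine ⟨fun i => ?_, ?_⟩
      · rw [h2]; exact abs_pos.2 (hx' i)
      · simpa only [h2] using h
    · rintro ⟨s, h1, h2⟩
      have h3 : ∀ i, |x i| = e s i * x i := fun i => by
        rw [← abs_of_pos (h1 i), abs_mul, he1, one_mul]
      simpa only [h3] using h2
  have hdisj : Pairwise (Function.onFun Disjoint O) := by
    intro s s' hne
    refine Set.disjoint_left.2 fun x hx hx' => hne (funext fun i => ?_)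
    have h1 := hx.1 i
    have h2 := hx'.1 i
    by_contra h
    have h4 : e s i * x i = -(e s' i * x i) := by
      dsimp only [e]
      cases h5 : s i <;> cases h6 : s' i <;> simp_all
    linarith
  have hvol : ∀ s, volume (O s) = volume (cornerSimplex n) := by
    intro s
    -- The piece for `s` is the reflection of the positive one; the diagonal matrix has determinant
    -- `±1`.
    have himg : O s = Matrix.toLin' (diagonal (e s)) ''
        {x | (∀ i, 0 < 1 * x i) ∧ ∑ i, 1 * x i ≤ 1} := by
      ext x
      constructor
      · intro hx
        refine ⟨fun i => e s i * x i, ?_, ?_⟩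
        · change (∀ i, _) ∧ _
          simp only [one_mul]
          exact hx
        · ext i
          simp only [toLin'_apply, mulVec_diagonal]
          rw [← mul_assoc, he, one_mul]
      · rintro ⟨y, hy, rfl⟩
        have : ∀ i, e s i * (toLin' (diagonal (e s)) y) i = 1 * y i := fun i => by
          simp only [toLin'_apply, mulVec_diagonal]
          rw [← mul_assoc, he]
        change (∀ i, _) ∧ _
        simp only [this]
        exact hy
    have hdet : |LinearMap.det (toLin' (diagonal (e s)))| = 1 := by
      rw [LinearMap.det_toLin', det_diagonal, Finset.abs_prod]
      simp [he1]
    rw [himg, Measure.addHaar_image_linearMap, hdet, ENNReal.ofReal_one, one_mul]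
    refine measure_congr ?_
    have hnull := measure_eq_zero_iff_ae_notMem.1 (volume_coordinate_hyperplanes n)
    filter_upwards [hnull] with x hx
    apply propext
    change ((∀ i, 0 < 1 * x i) ∧ ∑ i, 1 * x i ≤ 1) ↔ ((∀ i, 0 ≤ x i) ∧ ∑ i, x i ≤ 1)
    simp only [one_mul]
    exact and_congr_left fun _ => forall_congr' fun i =>
      ⟨le_of_lt, fun h => lt_of_le_of_ne h fun h0 => hx ⟨i, h0.symm⟩⟩
  rw [hunion, measure_iUnion hdisj fun s => measurableSet_openCorner n (e s)] at hball
  simp only [hvol, tsum_fintype, Finset.sum_const, Finset.card_univ, Fintype.card_fun,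
    Fintype.card_bool, Fintype.card_fin, nsmul_eq_mul] at hball
  have h2 : ENNReal.ofReal (2 ^ n / n.factorial) =
      ((2 ^ n : ℕ) : ENNReal) * ENNReal.ofReal (1 / n.factorial) := by
    rw [← ENNReal.ofReal_natCast, ← ENNReal.ofReal_mul (by positivity)]
    congr 1
    push_cast
    ring
  rw [h2] at hball
  exact (ENNReal.mul_right_inj (by simp) (ENNReal.natCast_ne_top _)).1 hball

theorem volume_coneSimplex {n N : ℕ} (hn : 1 ≤ n) (V : Fin N → Fin n → ℝ) (U : Fin n → Fin N) :
    volume (coneSimplex V U) = ENNReal.ofReal (|(columnMatrix V U).det| / n.factorial) := by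
  have : coneSimplex V U = Matrix.toLin' (columnMatrix V U) '' cornerSimplex n := by
    ext x
    rw [mem_coneSimplex_iff]
    constructor
    · rintro ⟨w, h1, h2, rfl⟩
      exact ⟨w, ⟨h1, h2⟩, by rw [toLin'_apply, columnMatrix_mulVec]⟩
    · rintro ⟨w, ⟨h1, h2⟩, rfl⟩
      exact ⟨w, h1, h2, by rw [toLin'_apply, columnMatrix_mulVec]⟩
  rw [this, Measure.addHaar_image_linearMap, volume_cornerSimplex hn, LinearMap.det_toLin',
    ← ENNReal.ofReal_mul (abs_nonneg _)]
  congr 1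
  ring

/-- Convex sets with disjoint interiors meet only in their frontiers, which are null sets; hence the
volumes add up. -/
theorem IsDecomposition.volume_eq {n N m : ℕ} (hn : 1 ≤ n) {V : Fin N → Fin n → ℝ}
    {U : Fin m → Fin n → Fin N} (h : IsDecomposition V U) :
    (volume (vPolytope V)).toReal = ∑ l, |(columnMatrix V (U l)).det| / (n.factorial : ℝ) := by
  have hconv : ∀ l, Convex ℝ (coneSimplex V (U l)) := fun l => convex_convexHull _ _
  rw [← h.iUnion_eq, measure_iUnion₀]
  · simp only [volume_coneSimplex hn, tsum_fintype]
    rw [ENNReal.toReal_sum fun _ _ => ENNReal.ofReal_ne_top]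
    exact Finset.sum_congr rfl fun l _ => ENNReal.toReal_ofReal (by positivity)
  · intro l l' hl
    have hd := h.disjoint hl
    have hsub : coneSimplex V (U l) ∩ coneSimplex V (U l') ⊆
        frontier (coneSimplex V (U l)) ∪ frontier (coneSimplex V (U l')) := by
      rintro x ⟨hx, hx'⟩
      by_cases h1 : x ∈ interior (coneSimplex V (U l))
      · exact Or.inr ⟨subset_closure hx', fun h2 => Set.disjoint_left.1 hd h1 h2⟩
      · exact Or.inl ⟨subset_closure hx, h1⟩
    change volume _ = 0
    exact measure_mono_null hsub (measure_union_null ((hconv l).addHaar_frontier volume)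
      ((hconv l').addHaar_frontier volume))
  · exact fun l => (hconv l).nullMeasurableSet volume

end

/-! ### The lexicographic perturbation -/

section

open Matrix Filter Topology

/-- The first nonzero one among `x` and the values of `g` is negative. -/
def LexNeg {n : ℕ} (x : ℝ) (g : Fin n → ℝ) : Prop :=
  x < 0 ∨ (x = 0 ∧ ∃ c, g c < 0 ∧ ∀ c' < c, g c' = 0)

/-- The coordinates of `V j` with respect to the points `V (U i)`. -/
noncomputable def basisCoord {n N : ℕ} (V : Fin N → Fin n → ℝ) (U : Fin n → Fin N) (j : Fin N) :
    Fin n → ℝ :=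
  (columnMatrix V U)⁻¹ *ᵥ V j

/-- The point `j` violates the constraint of the basis `U` when the costs `1` are perturbed
lexicographically. -/
def LexViolates {n N : ℕ} (V : Fin N → Fin n → ℝ) (U : Fin n → Fin N) (j : Fin N) : Prop :=
  -- The default `1` for `U i ≥ j` ends the comparison: the slack has coefficient `1` at `ε ^ (j +
  -- 1)` when `j` is outside the basis, so later coefficients cannot make it negative.
  LexNeg (1 - ∑ i, basisCoord V U j i) fun i => if U i < j then - basisCoord V U j i else 1

/-- The bases that are optimal for some objective with respect to the perturbed costs. -/
def LexFeasible {n N : ℕ} (V : Fin N → Fin n → ℝ) (U : Fin n → Fin N) : Prop :=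
  (columnMatrix V U).det ≠ 0 ∧ ∀ j, ¬ LexViolates V U j

theorem sum_basisCoord_smul {n N : ℕ} {V : Fin N → Fin n → ℝ} {U : Fin n → Fin N}
    (hdet : (columnMatrix V U).det ≠ 0) (j : Fin N) : ∑ i, basisCoord V U j i • V (U i) = V j := by
  rw [← columnMatrix_mulVec, basisCoord, mulVec_mulVec,
    mul_nonsing_inv _ (isUnit_iff_ne_zero.2 hdet), one_mulVec]

theorem basisCoord_self {n N : ℕ} {V : Fin N → Fin n → ℝ} {U : Fin n → Fin N}
    (hdet : (columnMatrix V U).det ≠ 0) (i : Fin n) : basisCoord V U (U i) = Pi.single i 1 := by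
  have h : V (U i) = columnMatrix V U *ᵥ Pi.single i 1 := by
    rw [columnMatrix_mulVec]
    simp [Pi.single_apply, ite_smul]
  rw [basisCoord, h, mulVec_mulVec, nonsing_inv_mul _ (isUnit_iff_ne_zero.2 hdet), one_mulVec]

theorem dotProduct_eq_sum_basisCoord {n N : ℕ} {V : Fin N → Fin n → ℝ} {U : Fin n → Fin N}
    (hdet : (columnMatrix V U).det ≠ 0) {c : Fin N → ℝ} {a : Fin n → ℝ}
    (ha : ∀ i, a ⬝ᵥ V (U i) = c (U i)) (j : Fin N) :
    a ⬝ᵥ V j = ∑ i, basisCoord V U j i * c (U i) := by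
  conv_lhs => rw [← sum_basisCoord_smul hdet j, dotProduct_sum]
  simp [dotProduct_smul, ha]

theorem exists_normal {n N : ℕ} {V : Fin N → Fin n → ℝ} {U : Fin n → Fin N}
    (hdet : (columnMatrix V U).det ≠ 0) (c : Fin N → ℝ) :
    ∃ a : Fin n → ℝ, ∀ i, a ⬝ᵥ V (U i) = c (U i) := by
  refine ⟨(fun i => c (U i)) ᵥ* (columnMatrix V U)⁻¹, fun i => ?_⟩
  rw [← vecMul_columnMatrix, vecMul_vecMul, nonsing_inv_mul _ (isUnit_iff_ne_zero.2 hdet),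
    vecMul_one]

theorem not_lexViolates_self {n N : ℕ} {V : Fin N → Fin n → ℝ} {U : Fin n → Fin N}
    (hdet : (columnMatrix V U).det ≠ 0) (i : Fin n) :
    ¬ LexViolates V U (U i) := by
  unfold LexViolates
  rw [basisCoord_self hdet]
  rintro (h | ⟨-, c, hc, -⟩)
  · simp at h
  · dsimp only at hc
    split_ifs at hc with h
    · rw [Pi.single_eq_of_ne (by rintro rfl; exact lt_irrefl _ h)] at hc
      simp at hc
    · linarith

/-- A polynomial in `ε` whose lowest coefficient is positive is positive for small `ε`. -/
theorem eventually_sum_pos {M m : ℕ} (hm : m < M) {q : ℕ → ℝ} (hq : 0 < q m)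
    (h0 : ∀ i < m, q i = 0) :
    ∀ᶠ ε in 𝓝[>] (0 : ℝ), 0 < ∑ i ∈ Finset.range M, q i * ε ^ i := by
  have hct : Continuous fun ε : ℝ => ∑ i ∈ Finset.range (M - m), q (m + i) * ε ^ i := by fun_prop
  have h1 := hct.tendsto 0
  have h2 : (∑ i ∈ Finset.range (M - m), q (m + i) * (0 : ℝ) ^ i) = q m := by
    rw [Finset.sum_eq_single 0]
    · simp
    · intro i _ hi; simp [hi]
    · intro h; simp at h; omega
  rw [h2] at h1
  filter_upwards [(h1.eventually (lt_mem_nhds hq)).filter_mono nhdsWithin_le_nhds,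
    self_mem_nhdsWithin] with ε h3 h4
  have h4' : (0 : ℝ) < ε := h4
  have h5 : ∑ i ∈ Finset.range M, q i * ε ^ i =
      ε ^ m * ∑ i ∈ Finset.range (M - m), q (m + i) * ε ^ i := by
    obtain ⟨M', rfl⟩ := Nat.exists_eq_add_of_le hm.le
    rw [Finset.sum_range_add, Finset.sum_eq_zero, zero_add, Nat.add_sub_cancel_left,
      Finset.mul_sum]
    · exact Finset.sum_congr rfl fun i _ => by ring
    · intro i hi
      rw [h0 i (Finset.mem_range.1 hi), zero_mul]
  rw [h5]
  positivity

/-- The coefficients of the slack of the point `j` as a polynomial in the perturbation. -/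
noncomputable def slackCoeff {n N : ℕ} (V : Fin N → Fin n → ℝ) (U : Fin n → Fin N) (j : Fin N) :
    ℕ → ℝ
  | 0 => 1 - ∑ i, basisCoord V U j i
  | m + 1 => (if (j : ℕ) = m then 1 else 0) - ∑ i, if (U i : ℕ) = m then basisCoord V U j i else 0

/-- Evaluated at `ε`, the polynomial is `c j - a ⬝ᵥ V j` for the costs `1 + ε ^ (j + 1)` and the
vector `a` that is tight on `U`. -/
theorem sum_slackCoeff {n N : ℕ} (V : Fin N → Fin n → ℝ) (U : Fin n → Fin N) (j : Fin N) (ε : ℝ) :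
    ∑ m ∈ Finset.range (N + 1), slackCoeff V U j m * ε ^ m =
      (1 + ε ^ (j + 1 : ℕ)) - ∑ i, basisCoord V U j i * (1 + ε ^ (U i + 1 : ℕ)) := by
  have h : ∀ l : Fin N, ∑ m ∈ Finset.range N, (if (l : ℕ) = m then ε ^ (m + 1) else 0) =
      ε ^ (l + 1 : ℕ) := fun l => by
    rw [Finset.sum_ite_eq, if_pos (Finset.mem_range.2 l.2)]
  rw [Finset.sum_range_succ']
  simp only [slackCoeff, sub_mul, Finset.sum_sub_distrib, ite_mul, one_mul, zero_mul,
    Finset.sum_mul, pow_zero, mul_one]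
  rw [h, Finset.sum_comm]
  have h2 : ∀ i, ∑ m ∈ Finset.range N, (if (U i : ℕ) = m then basisCoord V U j i * ε ^ (m + 1)
      else 0) = basisCoord V U j i * ε ^ (U i + 1 : ℕ) := fun i => by
    rw [← h, Finset.mul_sum]
    simp only [mul_ite, mul_zero]
  simp only [h2, mul_add, mul_one, Finset.sum_add_distrib]
  ring

theorem slackCoeff_succ {n N : ℕ} {V : Fin N → Fin n → ℝ} {U : Fin n → Fin N} (hU : StrictMono U)
    {j : Fin N} {i : Fin n} (hj : j ≠ U i) :
    slackCoeff V U j (U i + 1) = - basisCoord V U j i := by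
  have h1 : ∀ i', (if (U i' : ℕ) = U i then basisCoord V U j i' else 0) =
      if i' = i then basisCoord V U j i' else 0 := fun i' => by
    simp only [← Fin.ext_iff, hU.injective.eq_iff]
  simp only [slackCoeff]
  rw [if_neg fun h => hj (Fin.ext h)]
  simp [h1]

/-- This coefficient makes the slack polynomial of a point outside the basis nonzero, which is the
reason why the perturbed costs are generic. -/
theorem slackCoeff_self {n N : ℕ} {V : Fin N → Fin n → ℝ} {U : Fin n → Fin N}
    {j : Fin N} (hj : j ∉ Set.range U) : slackCoeff V U j (j + 1) = 1 := by
  simp only [slackCoeff]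
  rw [if_pos trivial, Finset.sum_eq_zero, sub_zero]
  intro i _
  rw [if_neg fun h => hj ⟨i, Fin.ext h⟩]

theorem eventually_slack_neg {n N : ℕ} {V : Fin N → Fin n → ℝ} {U : Fin n → Fin N}
    (hU : StrictMono U) {j : Fin N} (h : LexViolates V U j) :
    ∀ᶠ ε in 𝓝[>] (0 : ℝ),
      (1 + ε ^ (j + 1 : ℕ)) < ∑ i, basisCoord V U j i * (1 + ε ^ (U i + 1 : ℕ)) := by
  have key : ∀ m < N + 1, slackCoeff V U j m < 0 → (∀ i < m, slackCoeff V U j i = 0) →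
      ∀ᶠ ε in 𝓝[>] (0 : ℝ),
      (1 + ε ^ (j + 1 : ℕ)) < ∑ i, basisCoord V U j i * (1 + ε ^ (U i + 1 : ℕ)) := by
    intro m hm hneg hz
    have := eventually_sum_pos hm (q := fun i => - slackCoeff V U j i) (neg_pos.2 hneg)
      fun i hi => by rw [hz i hi, neg_zero]
    filter_upwards [this] with ε hε
    simp only [neg_mul, Finset.sum_neg_distrib, sum_slackCoeff] at hε
    linarith
  rcases h with h | ⟨h, i, hi, hz⟩
  · exact key 0 (Nat.succ_pos _) h fun i hi => absurd hi (Nat.not_lt_zero _)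
  · dsimp only at hi
    split_ifs at hi with hij
    · refine key (U i + 1) (Nat.succ_lt_succ (U i).2) ?_ fun m hm => ?_
      · rwa [slackCoeff_succ hU hij.ne']
      · rcases m with _ | m
        · exact h
        · have hm' : m < (U i : ℕ) := by omega
          have hij' : (U i : ℕ) < j := hij
          simp only [slackCoeff]
          rw [if_neg (by omega), Finset.sum_eq_zero, sub_zero]
          intro i' _
          split_ifs with h3
          · have h4 : i' < i := hU.lt_iff_lt.1 (by rw [Fin.lt_def, h3]; exact hm')
            have h5 := hz i' h4
            dsimp only at h5
            rw [if_pos ((hU h4).trans hij)] at h5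
            linarith
          · rfl
    · linarith

/-- The first nonzero coefficient has index at most `j + 1`, where the coefficient is `1`. The
earlier ones are the constant term, those of the basis indices below `j`, and zeros, so the
lexicographic test has seen all that matter. -/
theorem eventually_slack_pos {n N : ℕ} {V : Fin N → Fin n → ℝ} {U : Fin n → Fin N}
    (hU : StrictMono U) {j : Fin N} (hj : j ∉ Set.range U) (h : ¬ LexViolates V U j) :
    ∀ᶠ ε in 𝓝[>] (0 : ℝ),
      ∑ i, basisCoord V U j i * (1 + ε ^ (U i + 1 : ℕ)) < (1 + ε ^ (j + 1 : ℕ)) := by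
  have hex : ∃ m, slackCoeff V U j m ≠ 0 := ⟨j + 1, by rw [slackCoeff_self hj]; exact one_ne_zero⟩
  classical
  let m := Nat.find hex
  have hm0 : slackCoeff V U j m ≠ 0 := Nat.find_spec hex
  have hmz : ∀ i < m, slackCoeff V U j i = 0 := fun i hi => by
    have := Nat.find_min hex hi
    push Not at this
    exact this
  have hmj : m ≤ j + 1 := Nat.find_min' hex (by rw [slackCoeff_self hj]; exact one_ne_zero)
  have hpos : 0 < slackCoeff V U j m := by
    rcases hm : m with _ | l
    · rw [hm] at hm0
      exact lt_of_le_of_ne (not_lt.1 fun h0 => h (Or.inl h0)) hm0.symm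
    · rw [hm] at hm0
      rcases eq_or_ne l (j : ℕ) with rfl | hl
      · rw [slackCoeff_self hj]; exact one_pos
      · obtain ⟨i, hi⟩ : ∃ i, (U i : ℕ) = l := by
          by_contra hno
          push Not at hno
          apply hm0
          simp only [slackCoeff]
          rw [if_neg hl.symm, Finset.sum_eq_zero, sub_zero]
          intro i _
          rw [if_neg (hno i)]
        subst hi
        have hji : j ≠ U i := fun hji => hj ⟨i, hji.symm⟩
        have hlt : U i < j := by rw [Fin.lt_def]; omega
        rw [slackCoeff_succ hU hji] at hm0 ⊢
        refine lt_of_le_of_ne (not_lt.1 fun h0 => h (Or.inr ⟨hmz 0 (by omega), i, ?_, ?_⟩))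
          hm0.symm
        · simpa [hlt] using h0
        · intro i' hi'
          have h6 := hmz (U i' + 1) (by have := hU hi'; rw [Fin.lt_def] at this; omega)
          rw [slackCoeff_succ hU ((hU hi').trans hlt).ne'] at h6
          simp only [if_pos ((hU hi').trans hlt), h6]
  filter_upwards [eventually_sum_pos (M := N + 1) (by have := j.2; omega) hpos hmz] with ε hε
  rw [sum_slackCoeff] at hε
  linarith

/-- Numerical costs that realise the lexicographic perturbation. -/
theorem exists_perturbed_costs {n N : ℕ} (V : Fin N → Fin n → ℝ) :
    ∃ c : Fin N → ℝ, (∀ j, 0 < c j) ∧ GenericCosts V c ∧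
      ∀ U : Fin n → Fin N, StrictMono U → (columnMatrix V U).det ≠ 0 →
        (DualFeasible V c U ↔ LexFeasible V U) := by
  -- There are finitely many pairs `U`, `j`, so a single small `ε` gives all slacks their
  -- lexicographic signs.
  have hev : ∀ᶠ ε in 𝓝[>] (0 : ℝ), ∀ U : Fin n → Fin N, ∀ j : Fin N, StrictMono U →
      j ∉ Set.range U →
      (LexViolates V U j ∧
        (1 + ε ^ (j + 1 : ℕ)) < ∑ i, basisCoord V U j i * (1 + ε ^ (U i + 1 : ℕ))) ∨
      (¬ LexViolates V U j ∧
        ∑ i, basisCoord V U j i * (1 + ε ^ (U i + 1 : ℕ)) < (1 + ε ^ (j + 1 : ℕ))) := by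
    refine eventually_all.2 fun U => eventually_all.2 fun j => ?_
    by_cases hU : StrictMono U
    · by_cases hj : j ∈ Set.range U
      · exact Eventually.of_forall fun _ _ h => absurd hj h
      · by_cases hl : LexViolates V U j
        · filter_upwards [eventually_slack_neg hU hl] with ε hε _ _
          exact Or.inl ⟨hl, hε⟩
        · filter_upwards [eventually_slack_pos hU hj hl] with ε hε _ _
          exact Or.inr ⟨hl, hε⟩
    · exact Eventually.of_forall fun _ h => absurd h hU
  obtain ⟨ε, hε, h0⟩ := (hev.and self_mem_nhdsWithin).exists
  have h0' : (0 : ℝ) < ε := h0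
  refine ⟨fun j => 1 + ε ^ (j + 1 : ℕ), fun j => by positivity, ?_, ?_⟩
  · intro U hU hdet a ha j hj
    rw [dotProduct_eq_sum_basisCoord hdet (c := fun j => 1 + ε ^ (j + 1 : ℕ)) ha]
    rcases hε U j hU hj with h | h
    · exact h.2.ne'
    · exact h.2.ne
  · intro U hU hdet
    constructor
    · rintro ⟨a, ha, ha'⟩
      refine ⟨hdet, fun j hv => ?_⟩
      by_cases hj : j ∈ Set.range U
      · obtain ⟨i, rfl⟩ := hj
        exact not_lexViolates_self hdet i hv
      · have h1 := ha' j hj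
        rw [dotProduct_eq_sum_basisCoord hdet (c := fun j => 1 + ε ^ (j + 1 : ℕ)) ha] at h1
        rcases hε U j hU hj with h | h
        · exact lt_asymm h1 h.2
        · exact h.1 hv
    · rintro ⟨-, hl⟩
      obtain ⟨a, ha⟩ := exists_normal hdet fun j => 1 + ε ^ (j + 1 : ℕ)
      refine ⟨a, ha, fun j hj => ?_⟩
      rw [dotProduct_eq_sum_basisCoord hdet (c := fun j => 1 + ε ^ (j + 1 : ℕ)) ha]
      rcases hε U j hU hj with h | h
      · exact absurd h.1 (hl j)
      · exact h.2

/-- The normal of the facet of a lexicographically feasible basis. -/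
theorem LexFeasible.exists_facet_normal {n N : ℕ} {V : Fin N → Fin n → ℝ} {U : Fin n → Fin N}
    (h : LexFeasible V U) :
    ∃ a : Fin n → ℝ, (∀ i, a ⬝ᵥ V (U i) = 1) ∧ ∀ x ∈ vPolytope V, a ⬝ᵥ x ≤ 1 := by
  obtain ⟨a, ha⟩ := exists_normal h.1 fun _ => 1
  refine ⟨a, ha, fun x hx => dotProduct_le_of_mem_vPolytope (fun j => ?_) hx⟩
  -- For the unperturbed costs `1` the slack is the constant coefficient alone, and this is
  -- nonnegative if there is no violation.
  rw [dotProduct_eq_sum_basisCoord h.1 (c := fun _ => 1) ha]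
  have := h.2 j
  simp only [LexViolates, LexNeg, not_or, not_lt] at this
  simpa using this.1

theorem LexFeasible.spansFacet {n N : ℕ} (hn : 1 ≤ n) {V : Fin N → Fin n → ℝ}
    {U : Fin n → Fin N} (h : LexFeasible V U) : SpansFacet V U := by
  obtain ⟨a, ha, ha'⟩ := h.exists_facet_normal
  refine ⟨(det_columnMatrix_ne_zero.1 h.1).affineIndependent, a, 1, ?_, ha, ha'⟩
  rintro rfl
  simpa using ha ⟨0, hn⟩

/-- The bases that are feasible for the perturbed costs decompose the polytope. -/
theorem isDecomposition_of_lexFeasible {n N m : ℕ} (hn : 1 ≤ n) {V : Fin N → Fin n → ℝ}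
    (h0 : 0 ∈ interior (vPolytope V)) {U : Fin m → Fin n → Fin N} (hinj : Function.Injective U)
    (hU : ∀ W : Fin n → Fin N, (∃ l, U l = W) ↔ StrictMono W ∧ LexFeasible V W) :
    IsDecomposition V U := by
  obtain ⟨c, hc, hgen, hfeas⟩ := exists_perturbed_costs V
  have hUl : ∀ l, StrictMono (U l) ∧ LexFeasible V (U l) := fun l => (hU _).1 ⟨l, rfl⟩
  refine ⟨fun l => (hUl l).2.spansFacet hn, ?_, fun l l' hl => ?_⟩
  · refine Set.Subset.antisymm
      (Set.iUnion_subset fun l => coneSimplex_subset (interior_subset h0) _) fun x hx => ?_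
    obtain ⟨W, hW, hdet, hd, w, hw, hxw⟩ := exists_dualFeasible h0 hc hgen x
    have hl := (hfeas W hW hdet).1 hd
    obtain ⟨l, rfl⟩ := (hU W).2 ⟨hW, hl⟩
    refine Set.mem_iUnion.2 ⟨l, mem_coneSimplex_iff.2 ⟨w, hw, ?_, hxw⟩⟩
    -- The facet normal takes the value `1` on the basis, so `a ⬝ᵥ x` is the sum of the weights, and
    -- it is at most `1` since `x` lies in the polytope.
    obtain ⟨a, ha, ha'⟩ := hl.exists_facet_normal
    have h1 := ha' x hx
    rw [hxw, dotProduct_sum] at h1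
    simpa [dotProduct_smul, ha] using h1
  · exact disjoint_interior_coneSimplex (c := c) (hUl l).1 (hUl l').1 (fun h => hl (hinj h))
      (hUl l).2.1 (hUl l').2.1 ((hfeas _ (hUl l).1 (hUl l).2.1).2 (hUl l).2)
      ((hfeas _ (hUl l').1 (hUl l').2.1).2 (hUl l').2)

end

/-! ### The elimination program -/

section

open Matrix

namespace RealRAM

@[simp] theorem State.writeNat_nat_same (s : State) (a i v : ℕ) :
    (s.writeNat a i v).nat a = Function.update (s.nat a) i v := by simp [State.writeNat]

@[simp] theorem State.writeNat_nat_ne (s : State) {a b : ℕ} (i v : ℕ) (h : b ≠ a) :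
    (s.writeNat a i v).nat b = s.nat b := by simp [State.writeNat, h]

@[simp] theorem State.writeNat_real (s : State) (a i v : ℕ) : (s.writeNat a i v).real = s.real := rfl

@[simp] theorem State.writeReal_real_same (s : State) (a i : ℕ) (v : ℝ) :
    (s.writeReal a i v).real a = Function.update (s.real a) i v := by simp [State.writeReal]

@[simp] theorem State.writeReal_real_ne (s : State) {a b : ℕ} (i : ℕ) (v : ℝ) (h : b ≠ a) :
    (s.writeReal a i v).real b = s.real b := by simp [State.writeReal, h]

@[simp] theorem State.writeReal_nat (s : State) (a i : ℕ) (v : ℝ) :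
    (s.writeReal a i v).nat = s.nat := rfl

theorem runs_seq_frame {p q : Prog} {T₁ T₂ T : ℕ} {s : State} {R Q : State → Prop}
    (hp : Runs p T₁ s R) (hq : ∀ s', R s' → Frame p s s' → Runs q T₂ s' Q) (hT : T₁ + T₂ ≤ T) :
    Runs (Prog.seq p q) T s Q :=
  runs_seq (hp.mono_frame le_rfl hq) hT

/-- Each level of loop nesting raises the exponent of `N` by one; the overhead is absorbed into the
constant. -/
theorem loop_cost {b N T C p : ℕ} (hb : b ≤ N) (hN : 1 ≤ N) (hT : T ≤ C * N ^ p) :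
    b * (T + 13) + 10 ≤ (C + 23) * N ^ (p + 1) := by
  have h1 : 1 ≤ N ^ p := Nat.one_le_pow _ _ hN
  have h2 : T + 13 ≤ (C + 13) * N ^ p := by nlinarith
  have h3 : 1 ≤ N ^ (p + 1) := Nat.one_le_pow _ _ hN
  calc b * (T + 13) + 10 ≤ N * ((C + 13) * N ^ p) + 10 * N ^ (p + 1) :=
        Nat.add_le_add (Nat.mul_le_mul hb h2) (by omega)
    _ = (C + 23) * N ^ (p + 1) := by ring

/-- The memory holds the points `V` and the constants computed at the start. -/
structure Env {n N : ℕ} (V : Fin N → Fin n → ℝ) (s : State) : Prop where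
  one_le : 1 ≤ n
  le : n ≤ N
  dim : s.nat 0 0 = n
  points : s.nat 4 0 = N
  base : ∀ j : Fin N, s.nat 5 j = j * n
  coord : ∀ (j : Fin N) (i : Fin n), s.real 0 (j * n + i) = V j i
  factorial : s.real 4 0 = n.factorial

theorem Env.one_le_points {n N : ℕ} {V : Fin N → Fin n → ℝ} {s : State} (h : Env V s) : 1 ≤ N :=
  h.one_le.trans h.le

theorem Env.of_frame {n N : ℕ} {V : Fin N → Fin n → ℝ} {s s' : State} {p : Prog} (h : Env V s)
    (hf : Frame p s s') (hn : ∀ a ∈ [0, 4, 5], a ∉ p.natWrites)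
    (hr : ∀ a ∈ [0, 4], a ∉ p.realWrites) : Env V s' where
  one_le := h.one_le
  le := h.le
  dim := by rw [hf.1 0 (hn 0 (by decide)), h.dim]
  points := by rw [hf.1 4 (hn 4 (by decide)), h.points]
  base := by rw [hf.1 5 (hn 5 (by decide))]; exact h.base
  coord := by rw [hf.2 0 (hr 0 (by decide))]; exact h.coord
  factorial := by rw [hf.2 4 (hr 4 (by decide)), h.factorial]

/-- Cell `(r, j)` of the matrix whose columns are stored one after the other in array `a`. -/
def cell (a : ℕ) (j r : NExpr) : RExpr := RExpr.get a (NExpr.add (NExpr.get 5 j) r)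

/-- The working matrix, stored in real array `2`. -/
def matOf (n N : ℕ) (s : State) : Matrix (Fin n) (Fin N) ℝ := of fun r j => s.real 2 (j * n + r)

theorem matOf_apply {n N : ℕ} (s : State) (r : Fin n) (j : Fin N) :
    matOf n N s r j = s.real 2 (j * n + r) := rfl

theorem cell_index_inj {n : ℕ} {j j' : ℕ} {r r' : Fin n} :
    j * n + (r : ℕ) = j' * n + r' ↔ r = r' ∧ j = j' := by
  constructor
  · intro h
    have hn : 0 < n := r.pos
    have h1 : j = j' := by
      have := congrArg (· / n) h
      simpa [Nat.add_div_of_dvd_right, hn, Nat.div_eq_of_lt r.2, Nat.div_eq_of_lt r'.2] using this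
    subst h1
    exact ⟨Fin.ext (by omega), rfl⟩
  · rintro ⟨rfl, rfl⟩; rfl

theorem matOf_write {n N : ℕ} (s : State) (r r' : Fin n) (j j' : Fin N) (v : ℝ) :
    matOf n N (s.writeReal 2 (j * n + r) v) r' j' =
      if r' = r ∧ j' = j then v else matOf n N s r' j' := by
  simp only [matOf_apply, State.writeReal_real_same, Function.update_apply, cell_index_inj,
    Fin.ext_iff]

/-- Add the real variable `5` times row `ra` of the working matrix to row `ia`. -/
def rowOp (ia ra : ℕ) : Prog :=
  forLoop 23 4 (Prog.setReal 2 (NExpr.add (NExpr.get 5 (nvar 23)) (nvar ia))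
    (RExpr.add (cell 2 (nvar 23) (nvar ia))
      (RExpr.mul (rvar 5) (cell 2 (nvar 23) (nvar ra)))))

variable {n N : ℕ} {V : Fin N → Fin n → ℝ}

theorem runs_rowOp {s : State} (hE : Env V s) {ia ra : ℕ} (hia : ia ≠ 23) (hra : ra ≠ 23)
    {i r : Fin n} (hi : s.nat ia 0 = i) (hr : s.nat ra 0 = r) :
    Runs (rowOp ia ra) (50 * N) s fun s' =>
      matOf n N s' = rowAdd (matOf n N s) i r (s.real 5 0) := by
  have hN := hE.one_le_points
  -- Columns are treated independently, and the cells of a column are read before the write. Hence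
  -- the invariant also holds when `i = r`, the case used for scaling.
  refine runs_forLoop (T := 25) (b := N) (fun c s' => ∀ r' j, matOf n N s' r' j =
    if (j : ℕ) < c then rowAdd (matOf n N s) i r (s.real 5 0) r' j else matOf n N s r' j)
    (by decide) (by simp [Prog.natWrites]) (by simp [Prog.natWrites]) (fun _ _ _ h => h)
    hE.points (fun _ _ => by simp) ?_ (by omega) ?_
  · intro c s' hc hI hs' hf
    have hE' := hE.of_frame hf (by simp [Prog.natWrites, forLoop, assignNat])
      (by simp [Prog.realWrites, forLoop, assignNat])
    have h5 : s'.real 5 = s.real 5 := hf.2 5 (by simp [Prog.realWrites, forLoop, assignNat])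
    have hi' : s'.nat ia 0 = i := by
      rw [hf.1 ia (by simp [Prog.natWrites, forLoop, assignNat, hia]), hi]
    have hr' : s'.nat ra 0 = r := by
      rw [hf.1 ra (by simp [Prog.natWrites, forLoop, assignNat, hra]), hr]
    refine runs_setReal (by simp [NExpr.cost, RExpr.cost, nvar, rvar, cell]) fun r' j => ?_
    have hb := hE'.base ⟨c, hc⟩
    simp only [NExpr.eval, RExpr.eval, nvar, rvar, cell, hs', hi', hr', h5] at hb ⊢
    rw [hb]
    have h1 := matOf_write s' i r' ⟨c, hc⟩ j
    simp only at h1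
    rw [h1]
    have h2 := hI i ⟨c, hc⟩
    have h3 := hI r ⟨c, hc⟩
    simp only [lt_irrefl, if_false, matOf_apply s'] at h2 h3
    rw [h2, h3]
    split_ifs with h4 h6 h6
    · obtain ⟨rfl, rfl⟩ := h4
      rw [rowAdd_apply, if_pos rfl]
    · obtain ⟨rfl, rfl⟩ := h4
      exact absurd (Nat.lt_succ_self _) h6
    · rw [hI]
      rcases Nat.lt_succ_iff_lt_or_eq.1 h6 with h7 | h7
      · rw [if_pos h7]
      · have h8 : j = ⟨c, hc⟩ := Fin.ext h7
        rw [if_neg (by omega), rowAdd_apply, if_neg fun h9 => h4 ⟨h9, h8⟩]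
    · rw [hI, if_neg (by omega)]
  · intro s' hI _
    ext r' j
    rw [hI, if_pos j.2]

/-- The test that a real expression vanishes. -/
def isZero (x : RExpr) : Test := Test.and (Test.rle x (RExpr.const 0)) (Test.rle (RExpr.const 0) x)

theorem isZero_holds {s : State} {x : RExpr} : (isZero x).Holds s ↔ x.eval s = 0 := by
  simp [isZero, Test.Holds, RExpr.eval, le_antisymm_iff]

/-- The entry in row `r` (held in the variable `ra`) of the column that is being eliminated. -/
def pivotEntry (ra : ℕ) : RExpr := cell 2 (NExpr.get 7 (nvar 21)) (nvar ra)

/-- Natural array `7` lists `U`. -/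
def HoldsBasis (U : Fin n → Fin N) (s : State) : Prop := ∀ i : Fin n, s.nat 7 i = U i

theorem pivotEntry_eval {s : State} (hE : Env V s) {U : Fin n → Fin N} (hU : HoldsBasis U s)
    {c r : Fin n} {ra : ℕ} (hc : s.nat 21 0 = c) (hr : s.nat ra 0 = r) :
    (pivotEntry ra).eval s = matOf n N s r (U c) := by
  simp only [pivotEntry, cell, RExpr.eval, NExpr.eval, nvar, hc, hr, hU c, hE.base (U c)]
  rfl

/-- Make the pivot of column `21` nonzero if possible. -/
def searchPivot : Prog :=
  forLoop 22 0 (Prog.seq (Prog.cond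
    (Test.and (Test.not (Test.nle (nvar 22) (nvar 21))) (isZero (pivotEntry 21)))
    (assignReal 5 (RExpr.const 1)) (assignReal 5 (RExpr.const 0))) (rowOp 21 22))

theorem runs_searchPivot {s : State} (hE : Env V s) {U : Fin n → Fin N} (hU : HoldsBasis U s)
    {c : Fin n} (hc : s.nat 21 0 = c) (hA : Eliminated V U c (matOf n N s) (s.real 3 0)) :
    Runs searchPivot (200 * N ^ 2) s fun s' =>
      PivotSearched V U c n (matOf n N s') (s.real 3 0) := by
  have hN := hE.one_le_points
  refine runs_forLoop (T := 100 * N) (b := n)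
    (fun R s' => PivotSearched V U c R (matOf n N s') (s.real 3 0))
    (by decide) (by decide) (by decide) (fun _ _ _ h => h)
    hE.dim hA.pivotSearched ?_
    ((loop_cost (p := 1) (C := 100) hE.le hN (by simp)).trans (Nat.mul_le_mul_right _ (by norm_num)))
    fun _ h _ => h
  intro r s' hr hI hs' hf
  have hE' := hE.of_frame hf (by decide) (by decide)
  have hc' : s'.nat 21 0 = c := by rw [hf.1 21 (by decide), hc]
  have hU' : HoldsBasis U s' := by unfold HoldsBasis; rw [hf.1 7 (by decide)]; exact hU
  -- The row operation is performed in every round; where nothing is to be added, the multiplier in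
  -- the real variable `5` is zero.
  refine runs_seq_frame (T₁ := 50) (T₂ := 50 * N) (R := fun s'' =>
      s''.real 5 0 = if c < ⟨r, hr⟩ ∧ matOf n N s' c (U c) = 0 then 1 else 0)
    (p := Prog.cond _ _ _) ?_ ?_ (by omega)
  · refine runs_cond (T := 10) (by
        simp [Test.cost, NExpr.cost, RExpr.cost, nvar, isZero, pivotEntry, cell]) ?_ ?_
    · intro h
      simp only [Test.Holds, isZero_holds, pivotEntry_eval hE' hU' hc' hc', not_le, NExpr.eval,
        nvar, hs', hc'] at h
      refine runs_setReal (by simp [NExpr.cost, RExpr.cost]) ?_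
      rw [if_pos (by simpa [Fin.lt_def] using h)]
      simp [NExpr.eval, RExpr.eval]
    · intro h
      simp only [Test.Holds, isZero_holds, pivotEntry_eval hE' hU' hc' hc', not_le, NExpr.eval,
        nvar, hs', hc'] at h
      refine runs_setReal (by simp [NExpr.cost, RExpr.cost]) ?_
      rw [if_neg (by simpa [Fin.lt_def] using h)]
      simp [NExpr.eval, RExpr.eval]
  · intro s'' h5 hf'
    have hm : matOf n N s'' = matOf n N s' := by
      ext r j; simp only [matOf_apply]; rw [hf'.2 2 (by decide)]
    refine (runs_rowOp (i := c) (r := ⟨r, hr⟩) (hE'.of_frame hf' (by decide) (by decide))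
      (by decide) (by decide) (by rw [hf'.1 21 (by decide), hc'])
      (by rw [hf'.1 22 (by decide), hs'])).mono le_rfl fun s3 h3 => ?_
    rw [h3, h5, hm]
    exact hI.step (r := ⟨r, hr⟩)

/-- Clear column `21` except for its pivot. -/
def clearColumn : Prog :=
  forLoop 22 0 (Prog.seq (Prog.cond
    (Test.and (Test.nle (nvar 22) (nvar 21)) (Test.nle (nvar 21) (nvar 22)))
    (assignReal 5 (RExpr.const 0)) (assignReal 5 (RExpr.sub (RExpr.const 0) (pivotEntry 22))))
    (rowOp 22 21))

theorem runs_clearColumn {s : State} (hE : Env V s) {U : Fin n → Fin N} (hU : HoldsBasis U s)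
    {c : Fin n} (hc : s.nat 21 0 = c) (hA : ColumnCleared V U c 0 (matOf n N s) (s.real 3 0)) :
    Runs clearColumn (200 * N ^ 2) s fun s' =>
      ColumnCleared V U c n (matOf n N s') (s.real 3 0) := by
  have hN := hE.one_le_points
  refine runs_forLoop (T := 100 * N) (b := n)
    (fun R s' => ColumnCleared V U c R (matOf n N s') (s.real 3 0))
    (by decide) (by decide) (by decide) (fun _ _ _ h => h)
    hE.dim hA ?_
    ((loop_cost (p := 1) (C := 100) hE.le hN (by simp)).trans (Nat.mul_le_mul_right _ (by norm_num)))
    fun _ h _ => h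
  intro r s' hr hI hs' hf
  have hE' := hE.of_frame hf (by decide) (by decide)
  have hc' : s'.nat 21 0 = c := by rw [hf.1 21 (by decide), hc]
  have hU' : HoldsBasis U s' := by unfold HoldsBasis; rw [hf.1 7 (by decide)]; exact hU
  have hs2 : s'.nat 22 0 = (⟨r, hr⟩ : Fin n) := hs'
  refine runs_seq_frame (T₁ := 50) (T₂ := 50 * N) (R := fun s'' =>
      s''.real 5 0 = if (⟨r, hr⟩ : Fin n) = c then 0 else - matOf n N s' ⟨r, hr⟩ (U c))
    (p := Prog.cond _ _ _) ?_ ?_ (by omega)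
  · refine runs_cond (T := 20) (by simp [Test.cost, NExpr.cost, nvar]) ?_ ?_
    · intro h
      simp only [Test.Holds, NExpr.eval, nvar, hs', hc'] at h
      refine runs_setReal (by simp [NExpr.cost, RExpr.cost]) ?_
      rw [if_pos (Fin.ext (le_antisymm h.1 h.2))]
      simp [NExpr.eval, RExpr.eval]
    · intro h
      simp only [Test.Holds, NExpr.eval, nvar, hs', hc'] at h
      refine runs_setReal (by simp [NExpr.cost, RExpr.cost, pivotEntry, cell, nvar]) ?_
      rw [if_neg fun h' => h ⟨(Fin.ext_iff.1 h').le, (Fin.ext_iff.1 h').ge⟩]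
      simp [NExpr.eval, RExpr.eval, pivotEntry_eval hE' hU' hc' hs2]
  · intro s'' h5 hf'
    have hm : matOf n N s'' = matOf n N s' := by
      ext r j; simp only [matOf_apply]; rw [hf'.2 2 (by decide)]
    refine (runs_rowOp (i := ⟨r, hr⟩) (r := c) (hE'.of_frame hf' (by decide) (by decide))
      (by decide) (by decide) (by rw [hf'.1 22 (by decide), hs'])
      (by rw [hf'.1 21 (by decide), hc'])).mono le_rfl fun s3 h3 => ?_
    rw [h3, h5, hm]
    exact hI.step (r := ⟨r, hr⟩)

/-- Copy the points into the working matrix. -/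
def copyPoints : Prog :=
  forLoop 21 4 (forLoop 22 0 (Prog.setReal 2 (NExpr.add (NExpr.get 5 (nvar 21)) (nvar 22))
    (cell 0 (nvar 21) (nvar 22))))

theorem runs_copyPoints {s : State} (hE : Env V s) :
    Runs copyPoints (100 * N ^ 2) s fun s' => matOf n N s' = (of V)ᵀ := by
  have hN := hE.one_le_points
  refine runs_forLoop (T := 70 * N) (b := N)
    (fun c s' => ∀ (r : Fin n) (j : Fin N), (j : ℕ) < c → matOf n N s' r j = V j r)
    (by decide) (by decide) (by decide) (fun _ _ _ h => h)
    hE.points (fun _ _ h => absurd h (Nat.not_lt_zero _)) ?_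
    ((loop_cost (p := 1) (C := 70) le_rfl hN (by simp)).trans (Nat.mul_le_mul_right _ (by norm_num))) ?_
  · intro c s' hc hI hs' hf
    have hE' := hE.of_frame hf (by decide) (by decide)
    refine runs_forLoop (T := 30) (b := n)
      (fun c' s'' => ∀ (r : Fin n) (j : Fin N), ((j : ℕ) < c ∨ (j : ℕ) = c ∧ (r : ℕ) < c') →
        matOf n N s'' r j = V j r)
      (by decide) (by decide) (by decide) (fun _ _ _ h => h)
      hE'.dim (fun r j h => hI r j (by omega)) ?_
      ((loop_cost (p := 0) (C := 30) hE.le hN (by simp)).trans (by simp; omega)) ?_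
    · intro c' s'' hc' hI' hs'' hf'
      have hE'' := hE'.of_frame hf' (by decide) (by decide)
      refine runs_setReal (by simp [NExpr.cost, RExpr.cost, nvar, cell]) fun r j hj => ?_
      have h21 : s''.nat 21 0 = c := by rw [hf'.1 21 (by decide), hs']
      have hb := hE''.base ⟨c, hc⟩
      simp only [NExpr.eval, RExpr.eval, nvar, cell, h21, hs''] at hb ⊢
      rw [hb]
      have h1 := matOf_write s'' (⟨c', hc'⟩ : Fin n) r (⟨c, hc⟩ : Fin N) j
      simp only at h1
      rw [h1]
      have h2 := hE''.coord ⟨c, hc⟩ ⟨c', hc'⟩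
      simp only at h2
      rw [h2]
      split_ifs with h3
      · rw [h3.1, h3.2]
      · refine hI' r j ?_
        rcases hj with hj | ⟨hj, hr⟩
        · exact Or.inl hj
        · refine Or.inr ⟨hj, lt_of_le_of_ne (Nat.lt_succ_iff.1 hr) fun h4 => h3 ⟨Fin.ext h4,
            Fin.ext hj⟩⟩
    · intro s'' hI' _ r j hj
      exact hI' r j (by have := r.2; omega)
  · intro s' hI _
    ext r j
    rw [hI r j j.2]
    rfl

/-- Gauss–Jordan elimination: the real variable `3` becomes the determinant of the basis, and the
working matrix the coordinates of the points in terms of the basis. -/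
def eliminate : Prog :=
  Prog.seq copyPoints (Prog.seq (assignReal 3 (RExpr.const 1))
    (forLoop 21 0 (Prog.seq searchPivot
      (Prog.seq (assignReal 5 (RExpr.sub (RExpr.div (RExpr.const 1) (pivotEntry 21))
        (RExpr.const 1)))
      (Prog.seq (assignReal 3 (RExpr.mul (rvar 3) (pivotEntry 21)))
      (Prog.seq (rowOp 21 21) clearColumn))))))

theorem runs_eliminate {s : State} (hE : Env V s) {U : Fin n → Fin N} (hU : HoldsBasis U s) :
    Runs eliminate (800 * N ^ 3) s fun s' =>
      s'.real 3 0 = (columnMatrix V U).det ∧ ((columnMatrix V U).det ≠ 0 →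
        ∀ c j, matOf n N s' c j = basisCoord V U j c) := by
  have hN := hE.one_le_points
  have hN1 : 1 ≤ N ^ 2 := Nat.one_le_pow _ _ hN
  have hN2 : N ≤ N ^ 2 := Nat.le_self_pow (by norm_num) N
  have hN3 : N ^ 2 ≤ N ^ 3 := Nat.pow_le_pow_right hN (by norm_num)
  refine runs_seq_frame (T₂ := 700 * N ^ 3) (runs_copyPoints hE) ?_ (by omega)
  intro s1 h1 hf1
  have hE1 := hE.of_frame hf1 (by decide) (by decide)
  have hU1 : HoldsBasis U s1 := by unfold HoldsBasis; rw [hf1.1 7 (by decide)]; exact hU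
  refine runs_seq_frame (T₁ := 3) (T₂ := 600 * N ^ 3)
    (R := fun s' => s'.real 3 0 = 1) (p := assignReal _ _) (runs_setReal (by simp [NExpr.cost,
      RExpr.cost]) (by simp [NExpr.eval, RExpr.eval])) ?_ (by omega)
  intro s2 h2 hf2
  have hE2 := hE1.of_frame hf2 (by decide) (by decide)
  have hU2 : HoldsBasis U s2 := by unfold HoldsBasis; rw [hf2.1 7 (by decide)]; exact hU1
  have hm2 : matOf n N s2 = (of V)ᵀ := by
    rw [← h1]; ext r j; simp only [matOf_apply]; rw [hf2.2 2 (by decide)]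
  refine runs_forLoop (T := 550 * N ^ 2) (b := n)
    (fun c s' => Eliminated V U c (matOf n N s') (s'.real 3 0))
    (by decide) (by decide) (by decide) (fun _ _ _ h => h)
    hE2.dim (by rw [hm2, h2]; exact eliminated_zero) ?_
    ((loop_cost (p := 2) hE.le hN le_rfl).trans (Nat.mul_le_mul_right _ (by norm_num)))
    fun s' h _ => h.det_eq
  intro c s3 hc hI h21 hf3
  have hE3 := hE2.of_frame hf3 (by decide) (by decide)
  have hU3 : HoldsBasis U s3 := by unfold HoldsBasis; rw [hf3.1 7 (by decide)]; exact hU2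
  refine runs_seq_frame (T₂ := 350 * N ^ 2) (runs_searchPivot hE3 hU3 (c := ⟨c, hc⟩) h21 hI) ?_
    (by omega)
  intro s4 h4 hf4
  have hE4 := hE3.of_frame hf4 (by decide) (by decide)
  have hU4 : HoldsBasis U s4 := by unfold HoldsBasis; rw [hf4.1 7 (by decide)]; exact hU3
  have h21' : s4.nat 21 0 = (⟨c, hc⟩ : Fin n) := by rw [hf4.1 21 (by decide), h21]
  have h3' : s4.real 3 0 = s3.real 3 0 := by rw [hf4.2 3 (by decide)]
  have hp := pivotEntry_eval hE4 hU4 h21' h21'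
  rw [← h3'] at h4
  have h6 := h4.scale
  rw [← hp] at h6
  -- The multiplier and the new determinant are both computed before the row is scaled, while the
  -- old pivot is still in the matrix.
  refine runs_seq_frame (T₁ := 20) (T₂ := 320 * N ^ 2) (p := assignReal _ _)
    (R := fun s' => s'.real 5 0 = 1 / (pivotEntry 21).eval s4 - 1) (runs_setReal (by simp
      [NExpr.cost, RExpr.cost, pivotEntry, cell, nvar]) (by simp [NExpr.eval, RExpr.eval])) ?_
    (by omega)
  intro s5 h5 hf5
  have hE5 := hE4.of_frame hf5 (by decide) (by decide)
  have hU5 : HoldsBasis U s5 := by unfold HoldsBasis; rw [hf5.1 7 (by decide)]; exact hU4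
  have h21'' : s5.nat 21 0 = (⟨c, hc⟩ : Fin n) := by rw [hf5.1 21 (by decide), h21']
  have hm5 : matOf n N s5 = matOf n N s4 := by
    ext r j; simp only [matOf_apply]; rw [hf5.2 2 (by decide)]
  have hp5 := pivotEntry_eval hE5 hU5 h21'' h21''
  rw [hm5, ← hp] at hp5
  refine runs_seq_frame (T₁ := 20) (T₂ := 300 * N ^ 2) (p := assignReal _ _)
    (R := fun s' => s'.real 3 0 = s4.real 3 0 * (pivotEntry 21).eval s4) (runs_setReal (by simp
      [NExpr.cost, RExpr.cost, pivotEntry, cell, nvar, rvar]) (by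
        simp [NExpr.eval, RExpr.eval, rvar, hp5, hf5.2 3 (by decide)])) ?_
    (by omega)
  intro s6 hs6 hf6
  have hE6 := hE5.of_frame hf6 (by decide) (by decide)
  have hU6 : HoldsBasis U s6 := by unfold HoldsBasis; rw [hf6.1 7 (by decide)]; exact hU5
  have h216 : s6.nat 21 0 = (⟨c, hc⟩ : Fin n) := by rw [hf6.1 21 (by decide), h21'']
  have hm6 : matOf n N s6 = matOf n N s4 := by
    rw [← hm5]; ext r j; simp only [matOf_apply]; rw [hf6.2 2 (by decide)]
  refine runs_seq_frame (T₂ := 200 * N ^ 2)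
    (runs_rowOp hE6 (by decide) (by decide) h216 h216) ?_ (by omega)
  intro s7 h7 hf7
  have hE7 := hE6.of_frame hf7 (by decide) (by decide)
  have hU7 : HoldsBasis U s7 := by unfold HoldsBasis; rw [hf7.1 7 (by decide)]; exact hU6
  have h217 : s7.nat 21 0 = (⟨c, hc⟩ : Fin n) := by rw [hf7.1 21 (by decide), h216]
  have h37 : s7.real 3 0 = s6.real 3 0 := by rw [hf7.2 3 (by decide)]
  rw [← h5, ← hs6, ← hf6.2 5 (by decide), ← hm6, ← h7, ← h37] at h6
  refine (runs_clearColumn hE7 hU7 h217 h6).mono_frame le_rfl fun s8 h8 hf8 => ?_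
  rw [show s8.real 3 0 = s7.real 3 0 by rw [hf8.2 3 (by decide)]]
  exact h8.eliminated

end RealRAM

end

/-! ### The feasibility test and the output -/

section

open Matrix

namespace RealRAM

variable {n N : ℕ} {V : Fin N → Fin n → ℝ}

/-- One more term of a truncated sum. -/
theorem sum_ite_lt_succ (f : Fin n → ℝ) {i : ℕ} (hi : i < n) :
    (∑ c : Fin n, if (c : ℕ) < i + 1 then f c else 0) =
      (∑ c : Fin n, if (c : ℕ) < i then f c else 0) +
      f ⟨i, hi⟩ := by
  have h : ∀ c : Fin n, (if (c : ℕ) < i + 1 then f c else 0) =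
      (if (c : ℕ) < i then f c else 0) + if c = ⟨i, hi⟩ then f c else 0 := fun c => by
    by_cases h1 : (c : ℕ) < i
    · rw [if_pos h1, if_pos (by omega), if_neg fun h => by rw [h] at h1; exact lt_irrefl _ h1,
        add_zero]
    · by_cases h2 : (c : ℕ) = i
      · rw [if_pos (by omega), if_neg h1, if_pos (Fin.ext h2), zero_add]
      · rw [if_neg (by omega), if_neg h1, if_neg fun h => h2 (by rw [h]), add_zero]
  simp only [h, Finset.sum_add_distrib, Finset.sum_ite_eq', Finset.mem_univ, if_true]

/-- Compute the first nonzero term of the slack of the point `21`, and clear the flag `13` if it is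
negative. -/
def checkPoint : Prog :=
  Prog.seq (assignReal 6 (RExpr.const 1))
  (Prog.seq (forLoop 22 0 (assignReal 6 (RExpr.sub (rvar 6) (cell 2 (nvar 21) (nvar 22)))))
  (Prog.seq (forLoop 22 0 (Prog.cond (isZero (rvar 6))
    (Prog.cond (Test.not (Test.nle (nvar 21) (NExpr.get 7 (nvar 22))))
      (assignReal 6 (RExpr.sub (RExpr.const 0) (cell 2 (nvar 21) (nvar 22))))
      (assignReal 6 (RExpr.const 1))) Prog.skip))
    (Prog.cond (Test.rle (RExpr.const 0) (rvar 6)) Prog.skip (assignNat 13 (NExpr.const 0)))))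

theorem cell_eval {s : State} (hE : Env V s) {j : Fin N} {c : Fin n} (hj : s.nat 21 0 = j)
    (hc : s.nat 22 0 = c) : (cell 2 (nvar 21) (nvar 22)).eval s = matOf n N s c j := by
  simp only [cell, RExpr.eval, NExpr.eval, nvar, hj, hc, hE.base j]
  rfl

theorem matOf_frame {s s' : State} {p : Prog} (hf : Frame p s s') (h : 2 ∉ p.realWrites) :
    matOf n N s' = matOf n N s := by
  ext r j; simp only [matOf_apply]; rw [hf.2 2 h]

theorem HoldsBasis.of_frame {U : Fin n → Fin N} {s s' : State} {p : Prog} (hU : HoldsBasis U s)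
    (hf : Frame p s s') (h : 7 ∉ p.natWrites) : HoldsBasis U s' := by
  unfold HoldsBasis; rw [hf.1 7 h]; exact hU

/-- `LexNeg` with only the first `i` values of `g`. -/
def LexNegBelow (x : ℝ) (g : Fin n → ℝ) (i : ℕ) : Prop :=
  x < 0 ∨ (x = 0 ∧ ∃ c : Fin n, (c : ℕ) < i ∧ g c < 0 ∧ ∀ c' < c, g c' = 0)

theorem lexNegBelow_succ {x : ℝ} {g : Fin n → ℝ} {i : ℕ} (hi : i < n) :
    LexNegBelow x g (i + 1) ↔ LexNegBelow x g i ∨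
      (x = 0 ∧ (∀ c : Fin n, (c : ℕ) < i → g c = 0) ∧ g ⟨i, hi⟩ < 0) := by
  constructor
  · rintro (h | ⟨h, c, hc, hg, hz⟩)
    · exact Or.inl (Or.inl h)
    · rcases Nat.lt_succ_iff_lt_or_eq.1 hc with h1 | h1
      · exact Or.inl (Or.inr ⟨h, c, h1, hg, hz⟩)
      · obtain rfl : c = ⟨i, hi⟩ := Fin.ext h1
        exact Or.inr ⟨h, fun c' hc' => hz c' hc', hg⟩
  · rintro ((h | ⟨h, c, hc, hg, hz⟩) | ⟨h, hz, hg⟩)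
    · exact Or.inl h
    · exact Or.inr ⟨h, c, by omega, hg, hz⟩
    · exact Or.inr ⟨h, ⟨i, hi⟩, Nat.lt_succ_self _, hg, fun c' hc' => hz c' hc'⟩

theorem forall_lt_succ_fin {P : Fin n → Prop} {i : ℕ} (hi : i < n) :
    (∀ c : Fin n, (c : ℕ) < i + 1 → P c) ↔ (∀ c : Fin n, (c : ℕ) < i → P c) ∧ P ⟨i, hi⟩ := by
  refine ⟨fun h => ⟨fun c hc => h c (by omega), h _ (Nat.lt_succ_self _)⟩, fun h c hc => ?_⟩
  rcases Nat.lt_succ_iff_lt_or_eq.1 hc with h1 | h1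
  · exact h.1 c h1
  · obtain rfl : c = ⟨i, hi⟩ := Fin.ext h1
    exact h.2

/-- The real variable `6` is overwritten by the next coefficient only as long as it is zero, so it
ends with the first nonzero coefficient, if there is one. -/
theorem runs_checkPoint {s : State} (hE : Env V s) {U : Fin n → Fin N} (hU : HoldsBasis U s)
    {j : Fin N} (hj : s.nat 21 0 = j) :
    Runs checkPoint (250 * N) s fun s' => s'.nat 13 0 =
      (open Classical in if LexNeg (1 - ∑ c, matOf n N s c j)
        (fun c => if U c < j then - matOf n N s c j else 1) then 0 else s.nat 13 0) := by
  have hN := hE.one_le_points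
  set A := matOf n N s with hA
  set x := 1 - ∑ c, A c j with hx
  set g : Fin n → ℝ := fun c => if U c < j then - A c j else 1 with hg
  refine runs_seq_frame (T₁ := 3) (T₂ := 240 * N) (p := assignReal _ _)
    (R := fun s' => s'.real 6 0 = 1) (runs_setReal (by simp [NExpr.cost, RExpr.cost])
      (by simp [NExpr.eval, RExpr.eval])) ?_ (by omega)
  intro s1 h1 hf1
  have hE1 := hE.of_frame hf1 (by decide) (by decide)
  have hU1 := hU.of_frame hf1 (by decide)
  have hA1 : matOf n N s1 = A := matOf_frame hf1 (by decide)
  have hj1 : s1.nat 21 0 = j := by rw [hf1.1 21 (by decide), hj]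
  have h131 : s1.nat 13 = s.nat 13 := hf1.1 13 (by decide)
  refine runs_seq_frame (T₁ := 80 * N) (T₂ := 150 * N) (R := fun s' => s'.real 6 0 = x) ?_ ?_
    (by omega)
  · refine runs_forLoop (T := 20) (b := n)
      (fun i s' => s'.real 6 0 = 1 - ∑ c : Fin n, if (c : ℕ) < i then A c j else 0)
      (by decide) (by decide) (by decide) (fun _ _ _ h => h) hE1.dim (by simp [h1]) ?_
      ((loop_cost (p := 0) (C := 20) hE.le hN (by simp)).trans (by simp; omega)) ?_
    · intro i s' hi hI hs' hf
      have hE' := hE1.of_frame hf (by decide) (by decide)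
      have hA' : matOf n N s' = A := by rw [matOf_frame hf (by decide), hA1]
      have hj' : s'.nat 21 0 = j := by rw [hf.1 21 (by decide), hj1]
      refine runs_setReal (by simp [NExpr.cost, RExpr.cost, nvar, rvar, cell]) ?_
      have h2 := cell_eval hE' hj' (c := ⟨i, hi⟩) hs'
      rw [hA'] at h2
      rw [sum_ite_lt_succ _ hi]
      simp only [NExpr.eval, RExpr.eval, rvar, h2, State.writeReal_real_same,
        Function.update_self, hI]
      ring
    · intro s' h _
      rw [h, hx]
      congr 1
      exact Finset.sum_congr rfl fun c _ => if_pos c.2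
  intro s2 h2 hf2
  have hE2 := hE1.of_frame hf2 (by decide) (by decide)
  have hU2 := hU1.of_frame hf2 (by decide)
  have hA2 : matOf n N s2 = A := by rw [matOf_frame hf2 (by decide), hA1]
  have hj2 : s2.nat 21 0 = j := by rw [hf2.1 21 (by decide), hj1]
  have h132 : s2.nat 13 = s.nat 13 := by rw [hf2.1 13 (by decide), h131]
  refine runs_seq_frame (T₁ := 100 * N) (T₂ := 50 * N)
    (R := fun s' => s'.real 6 0 < 0 ↔ LexNeg x g) ?_ ?_ (by omega)
  · refine runs_forLoop (T := 45) (b := n)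
      -- The second equivalence is needed to know, when the variable is zero, that all coefficients
      -- seen so far vanish.
      (fun i s' => (s'.real 6 0 < 0 ↔ LexNegBelow x g i) ∧
        (s'.real 6 0 = 0 ↔ x = 0 ∧ ∀ c : Fin n, (c : ℕ) < i → g c = 0))
      (by decide) (by decide) (by decide) (fun _ _ _ h => h) hE2.dim
      (by simp [h2, LexNegBelow]) ?_
      ((loop_cost (p := 0) (C := 45) hE.le hN (by simp)).trans (by simp; omega)) ?_
    · intro i s' hi ⟨hI1, hI2⟩ hs' hf
      have hE' := hE2.of_frame hf (by decide) (by decide)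
      have hU' := hU2.of_frame hf (by decide)
      have hA' : matOf n N s' = A := by rw [matOf_frame hf (by decide), hA2]
      have hj' : s'.nat 21 0 = j := by rw [hf.1 21 (by decide), hj2]
      have hcell := cell_eval hE' hj' (c := ⟨i, hi⟩) hs'
      rw [hA'] at hcell
      simp only [lexNegBelow_succ hi, forall_lt_succ_fin hi]
      refine runs_cond (T := 30) (by simp [Test.cost, isZero, RExpr.cost, NExpr.cost, rvar])
        ?_ ?_
      · intro h0
        simp only [isZero_holds, rvar, RExpr.eval, NExpr.eval] at h0
        have h3 := hI2.1 h0
        have h4 : ¬ LexNegBelow x g i := by rw [← hI1, h0]; exact lt_irrefl _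
        have h5 : (s'.nat 7 i : ℕ) = U ⟨i, hi⟩ := hU' ⟨i, hi⟩
        have hfin : ∀ s'' : State, s''.real 6 0 = g ⟨i, hi⟩ →
            (s''.real 6 0 < 0 ↔ LexNegBelow x g i ∨
              (x = 0 ∧ (∀ c : Fin n, (c : ℕ) < i → g c = 0) ∧ g ⟨i, hi⟩ < 0)) ∧
            (s''.real 6 0 = 0 ↔ x = 0 ∧ (∀ c : Fin n, (c : ℕ) < i → g c = 0) ∧
              g ⟨i, hi⟩ = 0) := by
          intro s'' hs
          rw [hs]
          tauto
        refine runs_cond (T := 15) (by simp [Test.cost, NExpr.cost, nvar]) ?_ ?_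
        · intro h6
          simp only [Test.Holds, NExpr.eval, nvar, hj', hs', h5, not_le] at h6
          have hg1 : g ⟨i, hi⟩ = - A ⟨i, hi⟩ j := if_pos (Fin.lt_def.2 h6)
          refine runs_setReal (by simp [NExpr.cost, RExpr.cost, nvar, cell]) (hfin _ ?_)
          simp [NExpr.eval, RExpr.eval, hcell, hg1]
        · intro h6
          simp only [Test.Holds, NExpr.eval, nvar, hj', hs', h5, not_le] at h6
          have hg1 : g ⟨i, hi⟩ = 1 := if_neg fun h => h6 (Fin.lt_def.1 h)
          refine runs_setReal (by simp [NExpr.cost, RExpr.cost]) (hfin _ ?_)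
          simp [NExpr.eval, RExpr.eval, hg1]
      · intro h0
        simp only [isZero_holds, rvar, RExpr.eval, NExpr.eval] at h0
        have h3 : ¬ (x = 0 ∧ ∀ c : Fin n, (c : ℕ) < i → g c = 0) := fun h => h0 (hI2.2 h)
        refine runs_skip (by norm_num) ⟨?_, ?_⟩
        · rw [hI1]
          exact ⟨Or.inl, fun h => h.resolve_right fun h' => h3 ⟨h'.1, h'.2.1⟩⟩
        · constructor
          · intro h; exact absurd h h0
          · rintro ⟨h, h', -⟩; exact absurd ⟨h, h'⟩ h3
    · intro s' h _
      rw [h.1]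
      unfold LexNegBelow LexNeg
      simp
  intro s3 h3 hf3
  have h133 : s3.nat 13 = s.nat 13 := by rw [hf3.1 13 (by decide), h132]
  refine runs_cond (T := 3) (by simp [Test.cost, RExpr.cost, NExpr.cost, rvar]; omega) ?_ ?_
  · intro h
    simp only [Test.Holds, RExpr.eval, NExpr.eval, rvar, Rat.cast_zero] at h
    refine runs_skip (by norm_num) ?_
    rw [if_neg fun h' => not_lt.2 h (h3.2 h'), h133]
  · intro h
    simp only [Test.Holds, RExpr.eval, NExpr.eval, rvar, not_le, Rat.cast_zero] at h
    refine runs_setNat (by simp [NExpr.cost]) ?_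
    rw [if_pos (h3.1 h)]
    simp [NExpr.eval]

/-- Set the flag `13` if the current basis is feasible. -/
def checkBasis : Prog :=
  Prog.seq (assignNat 13 (NExpr.const 1)) (forLoop 21 4 checkPoint)

/-- Phrased in terms of the working matrix because the test is also run for singular `U`, when the
entries are not coordinates; the determinant is tested afterwards. -/
theorem runs_checkBasis {s : State} (hE : Env V s) {U : Fin n → Fin N} (hU : HoldsBasis U s) :
    Runs checkBasis (400 * N ^ 2) s fun s' => s'.nat 13 0 = 1 ↔
      ∀ j, ¬ LexNeg (1 - ∑ c, matOf n N s c j)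
        (fun c => if U c < j then - matOf n N s c j else 1) := by
  have hN := hE.one_le_points
  have hN1 : 1 ≤ N ^ 2 := Nat.one_le_pow _ _ hN
  refine runs_seq_frame (T₁ := 3) (T₂ := 390 * N ^ 2) (p := assignNat _ _)
    (R := fun s' => s'.nat 13 0 = 1) (runs_setNat (by simp [NExpr.cost])
      (by simp [NExpr.eval])) ?_ (by omega)
  intro s1 h1 hf1
  have hE1 := hE.of_frame hf1 (by decide) (by decide)
  have hU1 := hU.of_frame hf1 (by decide)
  have hA1 : matOf n N s1 = matOf n N s := matOf_frame hf1 (by decide)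
  refine runs_forLoop (T := 250 * N) (b := N)
    (fun i s' => s'.nat 13 0 = 1 ↔ ∀ j : Fin N, (j : ℕ) < i →
      ¬ LexNeg (1 - ∑ c, matOf n N s c j)
        (fun c => if U c < j then - matOf n N s c j else 1))
    (by decide) (by decide) (by decide) (fun _ _ _ h => by simpa using h) hE1.points
    (by simp [h1]) ?_
    ((loop_cost (p := 1) (C := 250) le_rfl hN (by simp)).trans
      (Nat.mul_le_mul_right _ (by norm_num))) (fun s' h _ => by simpa using h)
  intro i s' hi hI hs' hf
  have hE' := hE1.of_frame hf (by decide) (by decide)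
  have hA' : matOf n N s' = matOf n N s := by rw [matOf_frame hf (by decide), hA1]
  refine (runs_checkPoint hE' (hU1.of_frame hf (by decide)) (j := ⟨i, hi⟩) hs').mono le_rfl ?_
  intro s'' h
  rw [hA'] at h
  rw [forall_lt_succ_fin hi, ← hI, h]
  split_ifs with h2
  · simp [h2]
  · simp [h2]

/-- The simplices found so far, in the memory layout of the output, and the sum of their
volumes. -/
structure Listed (V : Fin N → Fin n → ℝ) (L : List (Fin n → Fin N)) (s : State) : Prop where
  count : s.nat 2 0 = L.length
  pointer : s.nat 9 0 = L.length * n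
  entry : ∀ (l : ℕ) (hl : l < L.length) (i : Fin n), s.nat 3 (l * n + i) = L[l] i
  volume : s.real 1 0 = (L.map fun U => |(columnMatrix V U).det| / (n.factorial : ℝ)).sum

theorem Listed.of_frame {L : List (Fin n → Fin N)} {s s' : State} {p : Prog} (h : Listed V L s)
    (hf : Frame p s s') (hn : ∀ a ∈ [2, 9, 3], a ∉ p.natWrites) (hr : 1 ∉ p.realWrites) :
    Listed V L s' where
  count := by rw [hf.1 2 (hn 2 (by decide)), h.count]
  pointer := by rw [hf.1 9 (hn 9 (by decide)), h.pointer]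
  entry := by rw [hf.1 3 (hn 3 (by decide))]; exact h.entry
  volume := by rw [hf.2 1 hr, h.volume]

/-- Append the current basis to the output. -/
def appendBasis : Prog :=
  Prog.seq (forLoop 22 0 (Prog.setNat 3 (NExpr.add (nvar 9) (nvar 22)) (NExpr.get 7 (nvar 22))))
  (Prog.seq (assignNat 9 (NExpr.add (nvar 9) (nvar 0)))
  (Prog.seq (assignNat 2 (NExpr.add (nvar 2) (NExpr.const 1)))
  (Prog.cond (Test.rle (RExpr.const 0) (rvar 3))
    (assignReal 1 (RExpr.add (rvar 1) (RExpr.div (rvar 3) (rvar 4))))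
    (assignReal 1 (RExpr.sub (rvar 1) (RExpr.div (rvar 3) (rvar 4)))))))

theorem runs_appendBasis {s : State} (hE : Env V s) {U : Fin n → Fin N} (hU : HoldsBasis U s)
    {L : List (Fin n → Fin N)} (hL : Listed V L s) (hdet : s.real 3 0 = (columnMatrix V U).det) :
    Runs appendBasis (100 * N) s (Listed V (L ++ [U])) := by
  have hN := hE.one_le_points
  refine runs_seq_frame (T₁ := 50 * N) (T₂ := 50 * N) (R := fun s' =>
      ∀ (l : ℕ) (hl : l < (L ++ [U]).length) (i : Fin n), s'.nat 3 (l * n + i) = (L ++ [U])[l] i)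
    ?_ ?_ (by omega)
  · refine runs_forLoop (T := 10) (b := n) (fun r s' =>
      (∀ (l : ℕ) (hl : l < L.length) (i : Fin n), s'.nat 3 (l * n + i) = L[l] i) ∧
      ∀ i : Fin n, (i : ℕ) < r → s'.nat 3 (L.length * n + i) = U i)
      (by decide) (by decide) (by decide) (fun _ _ _ h => by simpa using h) hE.dim
      ⟨hL.entry, fun _ h => absurd h (Nat.not_lt_zero _)⟩ ?_
      ((loop_cost (p := 0) (C := 10) hE.le hN (by simp)).trans (by simp; omega)) ?_
    · intro r s' hr ⟨hI1, hI2⟩ hs' hf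
      have h9 : s'.nat 9 0 = L.length * n := by rw [hf.1 9 (by decide), hL.pointer]
      have h7 := (hU.of_frame hf (by decide)) ⟨r, hr⟩
      simp only at h7
      refine runs_setNat (by simp [NExpr.cost, nvar]) ?_
      simp only [NExpr.eval, nvar, h9, hs', h7, State.writeNat_nat_same, Function.update_apply]
      have hinj := fun (l : ℕ) (i : Fin n) => cell_index_inj (j := l) (j' := L.length) (r := i)
        (r' := ⟨r, hr⟩)
      simp only at hinj
      refine ⟨fun l hl i => ?_, fun i hi => ?_⟩
      · rw [if_neg (by rw [hinj]; omega), hI1 l hl i]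
      · by_cases h : i = ⟨r, hr⟩
        · subst h; simp
        · rw [if_neg (by rw [hinj]; exact fun h' => h h'.1), hI2 i]
          exact lt_of_le_of_ne (Nat.lt_succ_iff.1 hi) fun h' => h (Fin.ext h')
    · rintro s' ⟨h1, h2⟩ _ l hl i
      by_cases h : l < L.length
      · rw [List.getElem_append_left h, h1 l h i]
      · rw [List.length_append, List.length_singleton] at hl
        obtain rfl : l = L.length := by omega
        rw [List.getElem_concat_length rfl, h2 i i.2]
  intro s1 h1 hf1
  refine runs_seq_frame (T₁ := 7) (T₂ := 40 * N) (p := assignNat _ _)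
    (R := fun s' => s'.nat 9 0 = (L ++ [U]).length * n) (runs_setNat (by simp [NExpr.cost, nvar])
      ?_) ?_ (by omega)
  · simp only [NExpr.eval, nvar, State.writeNat_nat_same, Function.update_self,
      hf1.1 9 (by decide), hf1.1 0 (by decide), hL.pointer, hE.dim, List.length_append,
      List.length_singleton]
    ring
  intro s2 h2 hf2
  refine runs_seq_frame (T₁ := 6) (T₂ := 30 * N) (p := assignNat _ _)
    (R := fun s' => s'.nat 2 0 = (L ++ [U]).length) (runs_setNat (by simp [NExpr.cost, nvar])
      ?_) ?_ (by omega)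
  · simp only [NExpr.eval, nvar, State.writeNat_nat_same, Function.update_self,
      hf2.1 2 (by decide), hf1.1 2 (by decide), hL.count, List.length_append,
      List.length_singleton]
  intro s3 h3 hf3
  have hr : s3.real = s.real := by
    funext a
    rw [hf3.2 a (by simp [Prog.realWrites, assignNat]),
      hf2.2 a (by simp [Prog.realWrites, assignNat]),
      hf1.2 a (by simp [Prog.realWrites, assignNat, forLoop])]
  -- The two branches of the final test compute `|det|`, so they share this conclusion.
  have hfin : ∀ v : ℝ, v = s.real 1 0 + |s.real 3 0| / s.real 4 0 →
      Listed V (L ++ [U]) (s3.writeReal 1 0 v) := by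
    intro v hv
    refine ⟨h3, ?_, ?_, ?_⟩
    · rw [State.writeReal_nat, hf3.1 9 (by decide), h2]
    · rw [State.writeReal_nat, hf3.1 3 (by decide), hf2.1 3 (by decide)]
      exact h1
    · simp [hv, hL.volume, hdet, hE.factorial]
  refine runs_cond (T := 20) (by simp [Test.cost, RExpr.cost, NExpr.cost, rvar]; omega) ?_ ?_
  · intro h
    simp only [Test.Holds, RExpr.eval, NExpr.eval, rvar, Rat.cast_zero, hr] at h
    refine runs_setReal (by simp [NExpr.cost, RExpr.cost, rvar]) (hfin _ ?_)
    simp only [NExpr.eval, RExpr.eval, rvar, hr, abs_of_nonneg h]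
  · intro h
    simp only [Test.Holds, RExpr.eval, NExpr.eval, rvar, Rat.cast_zero, hr, not_le] at h
    refine runs_setReal (by simp [NExpr.cost, RExpr.cost, rvar]) (hfin _ ?_)
    simp only [NExpr.eval, RExpr.eval, rvar, hr, abs_of_neg h]
    ring

end RealRAM

end

/-! ### Enumeration of the index sets -/

section

open Matrix

namespace RealRAM

/-- The increasing families `d` and `U` list complementary sets of indices. -/
def Complementary {n k N : ℕ} (d : Fin k → Fin N) (U : Fin n → Fin N) : Prop :=
  StrictMono d ∧ StrictMono U ∧ Set.range d = (Set.range U)ᶜ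

/-- After looking at the indices below `j`, the scan has recognised `d 0, …, d (q - 1)`, and `u`
lists the other indices. -/
structure Scanned (k : ℕ) (d : ℕ → ℕ) (j q : ℕ) (u : ℕ → ℕ) : Prop where
  le : q ≤ k
  le' : q ≤ j
  d_lt : ∀ i < q, d i < j
  d_mono : ∀ i i', i < i' → i' < q → d i < d i'
  u_lt : ∀ i < j - q, u i < j
  u_mono : ∀ i i', i < i' → i' < j - q → u i < u i'
  cover : ∀ x < j, (∃ i < q, d i = x) ∨ ∃ i < j - q, u i = x
  disjoint : ∀ i < q, ∀ i' < j - q, d i ≠ u i'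
  complete : (∀ i i', i < i' → i' < k → d i < d i') → ∀ i < k, d i < j → i < q

theorem Scanned.match {k : ℕ} {d : ℕ → ℕ} {j q : ℕ} {u : ℕ → ℕ} (h : Scanned k d j q u)
    (hq : q < k) (hd : d q = j) : Scanned k d (j + 1) (q + 1) u := by
  have hsub : j + 1 - (q + 1) = j - q := by omega
  constructor
  · exact hq
  · have := h.le'; omega
  · intro i hi
    rcases Nat.lt_succ_iff_lt_or_eq.1 hi with h1 | rfl
    · have := h.d_lt i h1; omega
    · omega
  · intro i i' hii hi'
    rcases Nat.lt_succ_iff_lt_or_eq.1 hi' with h1 | rfl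
    · exact h.d_mono i i' hii h1
    · rw [hd]; exact h.d_lt i hii
  · intro i hi
    rw [hsub] at hi
    have := h.u_lt i hi; omega
  · rw [hsub]; exact h.u_mono
  · intro x hx
    rw [hsub]
    rcases Nat.lt_succ_iff_lt_or_eq.1 hx with h1 | rfl
    · rcases h.cover x h1 with ⟨i, hi, h2⟩ | h2
      · exact Or.inl ⟨i, by omega, h2⟩
      · exact Or.inr h2
    · exact Or.inl ⟨q, by omega, hd⟩
  · intro i hi i' hi'
    rw [hsub] at hi'
    rcases Nat.lt_succ_iff_lt_or_eq.1 hi with h1 | rfl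
    · exact h.disjoint i h1 i' hi'
    · have := h.u_lt i' hi'; omega
  · intro hm i hi hdi
    by_contra h1
    have := hm q i (by omega) hi
    omega

theorem Scanned.skip {k : ℕ} {d : ℕ → ℕ} {j q : ℕ} {u : ℕ → ℕ} (h : Scanned k d j q u)
    (hq : ¬ (q < k ∧ d q = j)) : Scanned k d (j + 1) q (Function.update u (j - q) j) := by
  have hq' := h.le'
  have hsub : j + 1 - q = (j - q) + 1 := by omega
  have hu : ∀ i < j - q, Function.update u (j - q) j i = u i := fun i hi =>
    Function.update_of_ne hi.ne _ _
  have hu' : Function.update u (j - q) j (j - q) = j := Function.update_self _ _ _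
  constructor
  · exact h.le
  · omega
  · intro i hi
    have := h.d_lt i hi; omega
  · exact h.d_mono
  · intro i hi
    rw [hsub] at hi
    rcases Nat.lt_succ_iff_lt_or_eq.1 hi with h1 | rfl
    · rw [hu i h1]; have := h.u_lt i h1; omega
    · rw [hu']; omega
  · intro i i' hii hi'
    rw [hsub] at hi'
    rw [hu i (by omega)]
    rcases Nat.lt_succ_iff_lt_or_eq.1 hi' with h1 | rfl
    · rw [hu i' h1]; exact h.u_mono i i' hii h1
    · rw [hu']; exact h.u_lt i hii
  · intro x hx
    rw [hsub]
    rcases Nat.lt_succ_iff_lt_or_eq.1 hx with h1 | rfl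
    · rcases h.cover x h1 with h2 | ⟨i, hi, h2⟩
      · exact Or.inl h2
      · exact Or.inr ⟨i, by omega, by rw [hu i hi, h2]⟩
    · exact Or.inr ⟨_, Nat.lt_succ_self _, hu'⟩
  · intro i hi i' hi'
    rw [hsub] at hi'
    rcases Nat.lt_succ_iff_lt_or_eq.1 hi' with h1 | rfl
    · rw [hu i' h1]; exact h.disjoint i hi i' h1
    · rw [hu']; exact (h.d_lt i hi).ne
  · intro hm i hi hdi
    by_contra h1
    -- For an increasing tuple the first unrecognised digit is at least `j`; a digit equal to `j`
    -- would have to be this one, but it did not match.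
    have h2 : ¬ d q < j := fun h2 => absurd (h.complete hm q (by omega) h2) (lt_irrefl _)
    rcases (not_lt.1 h1).eq_or_lt with rfl | h3
    · exact hq ⟨hi, by omega⟩
    · have := hm q i h3 hi
      exact hq ⟨by omega, by omega⟩

/-- List the indices that are not among the digits (array `6`) in array `7`; the scalar `8` counts
the digits that were recognised. -/
def scanDigits : Prog :=
  Prog.seq (assignNat 8 (NExpr.const 0))
  (forLoop 21 4 (Prog.cond (Test.and (Test.not (Test.nle (nvar 1) (nvar 8)))
      (Test.and (Test.nle (NExpr.get 6 (nvar 8)) (nvar 21))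
        (Test.nle (nvar 21) (NExpr.get 6 (nvar 8)))))
    (assignNat 8 (NExpr.add (nvar 8) (NExpr.const 1)))
    (Prog.setNat 7 (NExpr.sub (nvar 21) (nvar 8)) (nvar 21))))

variable {n k : ℕ} {V : Fin (n + k) → Fin n → ℝ}

/-- One pass compares each index only with the next expected digit. All `k` digits are recognised
exactly if the tuple is increasing, so no index set is treated twice for different orders of its
complement. -/
theorem runs_scanDigits {s : State} (hE : Env V s) (hk : s.nat 1 0 = k) {d : Fin k → Fin (n + k)}
    (hd : ∀ i : Fin k, s.nat 6 i = d i) :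
    Runs scanDigits (100 * (n + k)) s fun s' =>
      (k ≤ s'.nat 8 0 ∧ ∃ U : Fin n → Fin (n + k), Complementary d U ∧ HoldsBasis U s') ∨
      (¬ k ≤ s'.nat 8 0 ∧ ¬ StrictMono d) := by
  have hN := hE.one_le_points
  refine runs_seq_frame (T₁ := 3) (T₂ := 95 * (n + k)) (p := assignNat _ _)
    (R := fun s' => s'.nat 8 0 = 0) (runs_setNat (by simp [NExpr.cost])
      (by simp [NExpr.eval])) ?_ (by omega)
  intro s1 h1 hf1
  have hE1 := hE.of_frame hf1 (by decide) (by decide)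
  refine runs_forLoop (T := 45) (b := n + k)
    (fun j s' => Scanned k (s.nat 6) j (s'.nat 8 0) (s'.nat 7))
    (by decide) (by decide) (by decide) (fun _ _ _ h => by simpa using h) hE1.points ?_ ?_
    ((loop_cost (p := 0) (C := 45) le_rfl hN (by simp)).trans (by simp; omega)) ?_
  · rw [h1]
    constructor <;> simp
  · intro j s' hj hI hs' hf
    have hk' : s'.nat 1 0 = k := by rw [hf.1 1 (by decide), hf1.1 1 (by decide), hk]
    have h6 : s'.nat 6 = s.nat 6 := by rw [hf.1 6 (by decide), hf1.1 6 (by decide)]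
    refine runs_cond (T := 9) (by simp [Test.cost, NExpr.cost, nvar]) ?_ ?_
    · intro h
      simp only [Test.Holds, NExpr.eval, nvar, hk', h6, hs'] at h
      refine runs_setNat (by simp [NExpr.cost, nvar]) ?_
      simpa [NExpr.eval, nvar] using hI.match (not_le.1 h.1) (le_antisymm h.2.1 h.2.2)
    · intro h
      simp only [Test.Holds, NExpr.eval, nvar, hk', h6, hs'] at h
      refine runs_setNat (by simp [NExpr.cost, nvar]) ?_
      simpa [NExpr.eval, nvar, hs'] using hI.skip fun h' => h ⟨not_le.2 h'.1, h'.2.le, h'.2.ge⟩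
  · intro s' h _
    by_cases hq : k ≤ s'.nat 8 0
    · have hq' : s'.nat 8 0 = k := le_antisymm h.le hq
      rw [hq'] at h
      have hsub : n + k - k = n := by omega
      refine Or.inl ⟨hq, fun i => ⟨s'.nat 7 i, h.u_lt i (by rw [hsub]; exact i.2)⟩, ⟨?_, ?_, ?_⟩,
        fun i => rfl⟩
      · intro i i' hii
        have := h.d_mono i i' hii i'.2
        rw [hd, hd] at this
        exact this
      · intro i i' hii
        exact h.u_mono i i' hii (by rw [hsub]; exact i'.2)
      · ext x
        rw [Set.mem_compl_iff]
        constructor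
        · rintro ⟨i, rfl⟩ ⟨i', hi'⟩
          refine h.disjoint i i.2 i' (by rw [hsub]; exact i'.2) ?_
          rw [hd, ← hi']
        · intro hx
          rcases h.cover x x.2 with ⟨i, hi, h2⟩ | ⟨i, hi, h2⟩
          · refine ⟨⟨i, hi⟩, Fin.ext ?_⟩
            rw [← hd, ← h2]
          · rw [hsub] at hi
            exact absurd ⟨⟨i, hi⟩, Fin.ext h2⟩ hx
    · refine Or.inr ⟨hq, fun hm => ?_⟩
      have h2 := h.complete (fun i i' hii hi' => by
        have := hm (show (⟨i, hii.trans hi'⟩ : Fin k) < ⟨i', hi'⟩ from hii)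
        rw [Fin.lt_def, ← hd, ← hd] at this
        exact this)
      have h3 := h2 (s'.nat 8 0) (not_le.1 hq) (by
        have := hd ⟨s'.nat 8 0, not_le.1 hq⟩
        simp only at this
        rw [this]
        exact Fin.is_lt _)
      exact lt_irrefl _ h3

/-- Count the digits (array `6`) up by one. -/
def incrementDigits : Prog :=
  Prog.seq (assignNat 12 (NExpr.const 1))
  (forLoop 21 1 (Prog.seq (Prog.setNat 6 (nvar 21) (NExpr.add (NExpr.get 6 (nvar 21)) (nvar 12)))
    (Prog.cond (Test.nle (nvar 4) (NExpr.get 6 (nvar 21)))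
      (Prog.seq (Prog.setNat 6 (nvar 21) (NExpr.const 0)) (assignNat 12 (NExpr.const 1)))
      (assignNat 12 (NExpr.const 0)))))

theorem digit_carry {N a c : ℕ} (hN : 1 ≤ N) (hc : c ≤ 1) :
    (N ≤ a % N + c → (a + c) % N = 0 ∧ (a + c) / N = a / N + 1) ∧
      (a % N + c < N → (a + c) % N = a % N + c ∧ (a + c) / N = a / N) := by
  have h1 : N * (a / N) + a % N = a := Nat.div_add_mod a N
  have h2 : a % N < N := Nat.mod_lt _ hN
  constructor
  · intro h
    have h3 : a + c = N * (a / N + 1) := by rw [mul_add]; omega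
    rw [h3]
    exact ⟨Nat.mul_mod_right _ _, Nat.mul_div_cancel_left _ hN⟩
  · intro h
    have h3 : a + c = (a % N + c) + N * (a / N) := by omega
    constructor
    · conv_lhs => rw [h3]
      rw [Nat.add_mul_mod_self_left, Nat.mod_eq_of_lt h]
    · conv_lhs => rw [h3]
      rw [Nat.add_mul_div_left _ _ hN, Nat.div_eq_of_lt h, zero_add]

theorem runs_incrementDigits {s : State} (hE : Env V s) (hk : s.nat 1 0 = k) {m : ℕ}
    (hd : ∀ i < k, s.nat 6 i = m / (n + k) ^ i % (n + k)) :
    Runs incrementDigits (100 * (n + k)) s fun s' =>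
      ∀ i < k, s'.nat 6 i = (m + 1) / (n + k) ^ i % (n + k) := by
  have hN := hE.one_le_points
  refine runs_seq_frame (T₁ := 3) (T₂ := 95 * (n + k)) (p := assignNat _ _)
    (R := fun s' => s'.nat 12 0 = 1) (runs_setNat (by simp [NExpr.cost])
      (by simp [NExpr.eval])) ?_ (by omega)
  intro s1 h1 hf1
  have hE1 := hE.of_frame hf1 (by decide) (by decide)
  -- The variable `12` is the carry into place `i`: the difference of `(m + 1) / N ^ i` and `m / N ^
  -- i`. After the last tuple the digits wrap around to zero, so no overflow test is needed.
  refine runs_forLoop (T := 45) (b := k) (fun i s' =>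
      (∀ i' < i, s'.nat 6 i' = (m + 1) / (n + k) ^ i' % (n + k)) ∧
      (∀ i', i ≤ i' → i' < k → s'.nat 6 i' = m / (n + k) ^ i' % (n + k)) ∧
      s'.nat 12 0 ≤ 1 ∧ m / (n + k) ^ i + s'.nat 12 0 = (m + 1) / (n + k) ^ i)
    (by decide) (by decide) (by decide) (fun _ _ _ h => by simpa using h)
    (by rw [hf1.1 1 (by decide), hk]) ?_ ?_
    ((loop_cost (p := 0) (C := 45) (Nat.le_add_left k n) hN (by simp)).trans
      (by simp; omega)) ?_
  · rw [h1, hf1.1 6 (by decide)]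
    exact ⟨fun _ h => absurd h (Nat.not_lt_zero _), fun i' _ hi' => hd i' hi', le_rfl, by simp⟩
  · intro i s' hi ⟨hI1, hI2, hI3, hI4⟩ hs' hf
    have hE' := hE1.of_frame hf (by decide) (by decide)
    have hdiv : ∀ x : ℕ, x / (n + k) ^ (i + 1) = x / (n + k) ^ i / (n + k) := fun x => by
      rw [pow_succ, Nat.div_div_eq_div_mul]
    have hcarry := digit_carry (a := m / (n + k) ^ i) hN hI3
    rw [hI4] at hcarry
    refine runs_seq_frame (T₁ := 10) (T₂ := 30) (p := Prog.setNat _ _ _)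
      (R := fun s'' => s''.nat 6 = Function.update (s'.nat 6) i
        (m / (n + k) ^ i % (n + k) + s'.nat 12 0))
      (runs_setNat (by simp [NExpr.cost, nvar])
        (by simp [NExpr.eval, nvar, hs', hI2 i le_rfl hi])) ?_ (by omega)
    intro s2 h6 hf2
    have h21 : s2.nat 21 0 = i := by rw [hf2.1 21 (by decide), hs']
    have h4 : s2.nat 4 0 = n + k := by rw [hf2.1 4 (by decide), hE'.points]
    refine runs_cond (T := 15) (by simp [Test.cost, NExpr.cost, nvar]) ?_ ?_
    · intro h
      simp only [Test.Holds, NExpr.eval, nvar, h21, h6, h4, Function.update_self] at h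
      obtain ⟨h7, h8⟩ := hcarry.1 h
      refine runs_seq_frame (T₁ := 4) (T₂ := 3) (p := Prog.setNat _ _ _)
        (R := fun s'' => s''.nat 6 = Function.update (s2.nat 6) i 0)
        (runs_setNat (by simp [NExpr.cost, nvar]) (by simp [NExpr.eval, nvar, h21])) ?_ (by omega)
      intro s3 h63 hf3
      refine runs_setNat (by simp [NExpr.cost]) ?_
      simp only [NExpr.eval, State.writeNat_nat_same, Function.update_self,
        State.writeNat_nat_ne _ _ _ (show (6 : ℕ) ≠ 12 by decide), h63, h6]
      refine ⟨fun i' hi' => ?_, fun i' hi' hi'' => ?_, le_rfl, ?_⟩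
      · rcases Nat.lt_succ_iff_lt_or_eq.1 hi' with h9 | rfl
        · rw [Function.update_of_ne h9.ne, Function.update_of_ne h9.ne, hI1 i' h9]
        · rw [Function.update_self, h7]
      · rw [Function.update_of_ne (by omega), Function.update_of_ne (by omega),
          hI2 i' (by omega) hi'']
      · rw [hdiv, hdiv, h8]
    · intro h
      simp only [Test.Holds, NExpr.eval, nvar, h21, h6, h4, Function.update_self, not_le] at h
      obtain ⟨h7, h8⟩ := hcarry.2 h
      refine runs_setNat (by simp [NExpr.cost]) ?_
      simp only [NExpr.eval, State.writeNat_nat_same, Function.update_self,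
        State.writeNat_nat_ne _ _ _ (show (6 : ℕ) ≠ 12 by decide), h6]
      refine ⟨fun i' hi' => ?_, fun i' hi' hi'' => ?_, by omega, ?_⟩
      · rcases Nat.lt_succ_iff_lt_or_eq.1 hi' with h9 | rfl
        · rw [Function.update_of_ne h9.ne, hI1 i' h9]
        · rw [Function.update_self, h7]
      · rw [Function.update_of_ne (by omega), hI2 i' (by omega) hi'']
      · rw [hdiv, hdiv, h8, add_zero]
  · intro s' h _ i hi
    exact h.1 i hi

/-- Treat the basis that is complementary to the current digits, and pass on to the next digits. -/
def roundProg : Prog :=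
  Prog.seq scanDigits
  (Prog.seq (Prog.cond (Test.nle (nvar 1) (nvar 8))
    (Prog.seq eliminate (Prog.seq checkBasis
      (Prog.cond (Test.and (Test.and (Test.nle (NExpr.const 1) (nvar 13))
          (Test.nle (nvar 13) (NExpr.const 1))) (Test.not (isZero (rvar 3))))
        appendBasis Prog.skip)))
    Prog.skip) incrementDigits)

/-- The list `L` consists of the feasible bases that are complementary to one of the first `m`
tuples of digits. -/
def ListsFeasible (V : Fin (n + k) → Fin n → ℝ) (m : ℕ) (L : List (Fin n → Fin (n + k))) : Prop :=
  L.Nodup ∧ ∀ W, W ∈ L ↔ LexFeasible V W ∧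
    ∃ e : Fin ((n + k) ^ k), (e : ℕ) < m ∧ Complementary (finFunctionFinEquiv.symm e) W

/-- Distinct tuples thus yield distinct bases, which keeps the output list free of repetitions. -/
theorem Complementary.left_unique {n k N : ℕ} {d d' : Fin k → Fin N} {U : Fin n → Fin N}
    (h : Complementary d U) (h' : Complementary d' U) : d = d' :=
  (h.1.range_inj h'.1).1 (h.2.2.trans h'.2.2.symm)

theorem Complementary.right_unique {n k N : ℕ} {d : Fin k → Fin N} {U U' : Fin n → Fin N}
    (h : Complementary d U) (h' : Complementary d U') : U = U' :=
  (h.2.1.range_inj h'.2.1).1 (compl_injective (h.2.2.symm.trans h'.2.2))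

theorem ListsFeasible.add {m : ℕ} {L : List (Fin n → Fin (n + k))} (h : ListsFeasible V m L)
    (hm : m < (n + k) ^ k) {U : Fin n → Fin (n + k)}
    (hU : Complementary (finFunctionFinEquiv.symm ⟨m, hm⟩) U) (hf : LexFeasible V U) :
    ListsFeasible V (m + 1) (L ++ [U]) := by
  refine ⟨?_, fun W => ?_⟩
  · rw [List.nodup_append]
    refine ⟨h.1, List.nodup_singleton _, fun W hW W' hW' => ?_⟩
    rw [List.mem_singleton] at hW'
    rintro rfl
    subst hW'
    obtain ⟨-, e, he, hc⟩ := (h.2 _).1 hW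
    have := finFunctionFinEquiv.symm.injective (hc.left_unique hU)
    rw [this] at he
    exact lt_irrefl _ he
  · rw [List.mem_append, List.mem_singleton, h.2]
    constructor
    · rintro (⟨h1, e, he, h2⟩ | rfl)
      · exact ⟨h1, e, by omega, h2⟩
      · exact ⟨hf, ⟨m, hm⟩, Nat.lt_succ_self _, hU⟩
    · rintro ⟨h1, e, he, h2⟩
      rcases Nat.lt_succ_iff_lt_or_eq.1 he with h3 | h3
      · exact Or.inl ⟨h1, e, h3, h2⟩
      · have h4 : e = ⟨m, hm⟩ := Fin.ext h3
        rw [h4] at h2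
        exact Or.inr (h2.right_unique hU)

theorem ListsFeasible.skip {m : ℕ} {L : List (Fin n → Fin (n + k))} (h : ListsFeasible V m L)
    (hm : m < (n + k) ^ k)
    (hU : ∀ U : Fin n → Fin (n + k), Complementary (finFunctionFinEquiv.symm ⟨m, hm⟩) U →
      ¬ LexFeasible V U) : ListsFeasible V (m + 1) L := by
  refine ⟨h.1, fun W => ?_⟩
  rw [h.2]
  constructor
  · rintro ⟨h1, e, he, h2⟩
    exact ⟨h1, e, by omega, h2⟩
  · rintro ⟨h1, e, he, h2⟩
    rcases Nat.lt_succ_iff_lt_or_eq.1 he with h3 | h3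
    · exact ⟨h1, e, h3, h2⟩
    · have h4 : e = ⟨m, hm⟩ := Fin.ext h3
      rw [h4] at h2
      exact absurd h1 (hU W h2)

theorem runs_roundProg {s : State} (hE : Env V s) (hk : s.nat 1 0 = k) {m : ℕ}
    (hm : m < (n + k) ^ k) (hd : ∀ i < k, s.nat 6 i = m / (n + k) ^ i % (n + k))
    {L : List (Fin n → Fin (n + k))} (hL : Listed V L s) (hF : ListsFeasible V m L) :
    Runs roundProg (2000 * (n + k) ^ 3) s fun s' =>
      (∀ i < k, s'.nat 6 i = (m + 1) / (n + k) ^ i % (n + k)) ∧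
      ∃ L', Listed V L' s' ∧ ListsFeasible V (m + 1) L' := by
  have hN := hE.one_le_points
  have hN1 : n + k ≤ (n + k) ^ 3 := Nat.le_self_pow (by norm_num) _
  have hN2 : (n + k) ^ 2 ≤ (n + k) ^ 3 := Nat.pow_le_pow_right hN (by norm_num)
  set d : Fin k → Fin (n + k) := finFunctionFinEquiv.symm ⟨m, hm⟩ with hdd
  have hd' : ∀ i : Fin k, s.nat 6 i = d i := fun i => hd i i.2
  refine runs_seq_frame (T₂ := 1800 * (n + k) ^ 3) (runs_scanDigits hE hk hd') ?_ (by omega)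
  intro s1 h1 hf1
  have hE1 := hE.of_frame hf1 (by decide) (by decide)
  have hL1 := hL.of_frame hf1 (by decide) (by decide)
  have hk1 : s1.nat 1 0 = k := by rw [hf1.1 1 (by decide), hk]
  refine runs_seq_frame (T₁ := 1600 * (n + k) ^ 3) (T₂ := 100 * (n + k))
    (R := fun s' => ∃ L', Listed V L' s' ∧ ListsFeasible V (m + 1) L') ?_ ?_ (by omega)
  · refine runs_cond (T := 1500 * (n + k) ^ 3) (by simp [Test.cost, NExpr.cost, nvar]; omega)
      ?_ ?_
    · intro h
      simp only [Test.Holds, NExpr.eval, nvar, hk1] at h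
      obtain ⟨U, hc, hU⟩ : ∃ U : Fin n → Fin (n + k), Complementary d U ∧ HoldsBasis U s1 := by
        rcases h1 with h1 | h1
        · exact h1.2
        · exact absurd h h1.1
      refine runs_seq_frame (T₂ := 600 * (n + k) ^ 3) (runs_eliminate hE1 hU) ?_ (by omega)
      intro s2 ⟨h2, h2'⟩ hf2
      have hE2 := hE1.of_frame hf2 (by decide) (by decide)
      have hU2 := hU.of_frame hf2 (by decide)
      have hL2 := hL1.of_frame hf2 (by decide) (by decide)
      refine runs_seq_frame (T₂ := 150 * (n + k)) (runs_checkBasis hE2 hU2) ?_ (by omega)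
      intro s3 h3 hf3
      have hE3 := hE2.of_frame hf3 (by decide) (by decide)
      have hU3 := hU2.of_frame hf3 (by decide)
      have hL3 := hL2.of_frame hf3 (by decide) (by decide)
      have hdet : s3.real 3 0 = (columnMatrix V U).det := by rw [hf3.2 3 (by decide), h2]
      -- Only under a nonzero determinant may the matrix entries be replaced by the coordinates, so
      -- the flag is interpreted within that case.
      have hfeas : LexFeasible V U ↔ s3.nat 13 0 = 1 ∧ s3.real 3 0 ≠ 0 := by
        rw [hdet, LexFeasible, and_comm]
        refine and_congr_left fun hne => ?_
        rw [h3]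
        simp only [LexViolates, h2' hne]
      refine runs_cond (T := 100 * (n + k))
        (by simp [Test.cost, NExpr.cost, RExpr.cost, nvar, rvar, isZero]; omega) ?_ ?_
      · intro h4
        simp only [Test.Holds, NExpr.eval, RExpr.eval, nvar, rvar, isZero_holds] at h4
        have hU4 := hfeas.2 ⟨le_antisymm h4.1.2 h4.1.1, h4.2⟩
        exact (runs_appendBasis hE3 hU3 hL3 hdet).mono le_rfl fun s4 h5 =>
          ⟨_, h5, hF.add hm hc hU4⟩
      · intro h4
        simp only [Test.Holds, NExpr.eval, RExpr.eval, nvar, rvar, isZero_holds] at h4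
        refine runs_skip (by omega) ⟨L, hL3, hF.skip hm fun W hW hWf => ?_⟩
        rw [hW.right_unique hc] at hWf
        have h5 := hfeas.1 hWf
        exact h4 ⟨⟨h5.1.ge, h5.1.le⟩, h5.2⟩
    · intro h
      simp only [Test.Holds, NExpr.eval, nvar, hk1] at h
      refine runs_skip (by omega) ⟨L, hL1, hF.skip hm fun U hU => ?_⟩
      rcases h1 with h1 | h1
      · exact absurd h1.1 h
      · exact absurd hU.1 h1.2
  · intro s2 ⟨L', hL', hF'⟩ hf2
    have hE2 := hE1.of_frame hf2 (by decide) (by decide)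
    refine (runs_incrementDigits hE2 (by rw [hf2.1 1 (by decide), hk1]) (m := m) ?_).mono_frame
      le_rfl fun s3 h3 hf3 => ⟨h3, L', hL'.of_frame hf3 (by decide) (by decide), hF'⟩
    rw [hf2.1 6 (by decide), hf1.1 6 (by decide)]
    exact hd

end RealRAM

end

/-! ### Preparation and the whole program -/

section

open Matrix

namespace RealRAM

variable {n k : ℕ} {V : Fin (n + k) → Fin n → ℝ}

/-- Compute the constants: the number `N` of points, the multiples of `n`, `n !`, and `N ^ k`. -/
def prepare : Prog :=
  Prog.seq (assignNat 4 (NExpr.add (nvar 0) (nvar 1)))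
  (Prog.seq (forLoop 21 4 (Prog.setNat 5 (NExpr.add (nvar 21) (NExpr.const 1))
    (NExpr.add (NExpr.get 5 (nvar 21)) (nvar 0))))
  (Prog.seq (assignReal 4 (RExpr.const 1))
  (Prog.seq (forLoop 21 0 (Prog.seq (assignReal 7 (RExpr.add (rvar 7) (RExpr.const 1)))
    (assignReal 4 (RExpr.mul (rvar 4) (rvar 7)))))
  (Prog.seq (assignNat 10 (NExpr.const 1))
  (forLoop 21 1 (Prog.seq (assignNat 11 (NExpr.const 0))
    (Prog.seq (forLoop 22 4 (assignNat 11 (NExpr.add (nvar 11) (nvar 10))))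
      (assignNat 10 (nvar 11)))))))))

/-- Natural numbers cannot be multiplied, so the column addresses and `N ^ k` are obtained by
repeated addition. They cannot be converted to reals either, so `n !` is built with a real counter,
which relies on real array `7` being zero at the start. -/
theorem runs_prepare (hn : 1 ≤ n) (V : Fin (n + k) → Fin n → ℝ) :
    Runs prepare (500 * (n + k) ^ 2) (inputState V) fun s => Env V s ∧ s.nat 1 0 = k ∧
      s.nat 10 0 = (n + k) ^ k ∧ (∀ i, s.nat 6 i = 0) ∧ Listed V [] s := by
  have hN : 1 ≤ n + k := by omega
  have hN1 : n + k ≤ (n + k) ^ 2 := Nat.le_self_pow (by norm_num) _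
  refine Runs.mono_frame (T := 500 * (n + k) ^ 2) (Q := fun s => s.nat 4 0 = n + k ∧
    (∀ j ≤ n + k, s.nat 5 j = j * n) ∧ s.real 4 0 = n.factorial ∧ s.nat 10 0 = (n + k) ^ k) ?_
    le_rfl ?_
  · refine runs_seq_frame (T₁ := 7) (T₂ := 490 * (n + k) ^ 2) (p := assignNat _ _)
      (R := fun s' => s'.nat 4 0 = n + k) (runs_setNat (by simp [NExpr.cost, nvar])
        (by simp [NExpr.eval, nvar, inputState])) ?_ (by omega)
    intro s1 h1 hf1
    have h10 : s1.nat 0 0 = n := by rw [hf1.1 0 (by decide)]; simp [inputState]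
    refine runs_seq_frame (T₁ := 50 * (n + k)) (T₂ := 430 * (n + k) ^ 2)
      (R := fun s' => ∀ j ≤ n + k, s'.nat 5 j = j * n) ?_ ?_ (by omega)
    · refine runs_forLoop (T := 15) (b := n + k) (fun i s' => ∀ j ≤ i, s'.nat 5 j = j * n)
        (by decide) (by decide) (by decide) (fun _ _ _ h => by simpa using h) h1 ?_ ?_
        ((loop_cost (p := 0) (C := 15) le_rfl hN (by simp)).trans (by simp; omega))
        fun _ h _ => h
      · intro j hj
        obtain rfl := Nat.le_zero.1 hj
        rw [hf1.1 5 (by decide)]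
        simp [inputState]
      · intro i s' hi hI hs' hf
        have h0 : s'.nat 0 0 = n := by rw [hf.1 0 (by decide), h10]
        refine runs_setNat (by simp [NExpr.cost, nvar]) fun j hj => ?_
        simp only [NExpr.eval, nvar, hs', h0, hI i le_rfl, State.writeNat_nat_same,
          Function.update_apply]
        split_ifs with h
        · rw [h]; ring
        · exact hI j (by omega)
    intro s2 h2 hf2
    have h20 : s2.nat 0 0 = n := by rw [hf2.1 0 (by decide), h10]
    refine runs_seq_frame (T₁ := 3) (T₂ := 420 * (n + k) ^ 2) (p := assignReal _ _)
      (R := fun s' => s'.real 4 0 = 1) (runs_setReal (by simp [NExpr.cost, RExpr.cost])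
        (by simp [NExpr.eval, RExpr.eval])) ?_ (by omega)
    intro s3 h3 hf3
    have h30 : s3.nat 0 0 = n := by rw [hf3.1 0 (by decide), h20]
    have h37 : s3.real 7 0 = 0 := by
      rw [hf3.2 7 (by decide), hf2.2 7 (by decide), hf1.2 7 (by decide)]
      simp [inputState]
    refine runs_seq_frame (T₁ := 50 * (n + k)) (T₂ := 350 * (n + k) ^ 2)
      (R := fun s' => s'.real 4 0 = n.factorial) ?_ ?_ (by omega)
    · refine runs_forLoop (T := 20) (b := n)
        (fun i s' => s'.real 7 0 = i ∧ s'.real 4 0 = i.factorial)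
        (by decide) (by decide) (by decide) (fun _ _ _ h => h) h30 (by simp [h3, h37]) ?_
        ((loop_cost (p := 0) (C := 20) (Nat.le_add_right n k) hN (by simp)).trans
          (by simp; omega)) fun _ h _ => h.2
      intro i s' hi ⟨hI1, hI2⟩ hs' hf
      refine runs_seq (T₁ := 7) (T₂ := 10) (runs_setReal (by simp [NExpr.cost, RExpr.cost, rvar])
        (runs_setReal (by simp [NExpr.cost, RExpr.cost, rvar]) ?_)) (by omega)
      simp [NExpr.eval, RExpr.eval, rvar, hI1, hI2, Nat.factorial_succ, mul_comm]
    intro s4 h4 hf4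
    refine runs_seq_frame (T₁ := 3) (T₂ := 340 * (n + k) ^ 2) (p := assignNat _ _)
      (R := fun s' => s'.nat 10 0 = 1) (runs_setNat (by simp [NExpr.cost])
        (by simp [NExpr.eval])) ?_ (by omega)
    intro s5 h5 hf5
    have h51 : s5.nat 1 0 = k := by
      rw [hf5.1 1 (by decide), hf4.1 1 (by decide), hf3.1 1 (by decide), hf2.1 1 (by decide),
        hf1.1 1 (by decide)]
      simp [inputState]
    have h54 : s5.nat 4 0 = n + k := by
      rw [hf5.1 4 (by decide), hf4.1 4 (by decide), hf3.1 4 (by decide), hf2.1 4 (by decide), h1]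
    refine Runs.mono_frame (T := 340 * (n + k) ^ 2) (Q := fun s' => s'.nat 10 0 = (n + k) ^ k) ?_
      le_rfl fun s6 h6 hf6 => ⟨?_, ?_, ?_, h6⟩
    · refine runs_forLoop (T := 100 * (n + k)) (b := k) (fun i s' => s'.nat 10 0 = (n + k) ^ i)
        (by decide) (by decide) (by decide) (fun _ _ _ h => by simpa using h) h51 (by simp [h5]) ?_
        ((loop_cost (p := 1) (C := 100) (Nat.le_add_left k n) hN (by simp)).trans
          (Nat.mul_le_mul_right _ (by norm_num))) fun _ h _ => h
      intro i s' hi hI hs' hf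
      have h54' : s'.nat 4 0 = n + k := by rw [hf.1 4 (by decide), h54]
      refine runs_seq_frame (T₁ := 3) (T₂ := 90 * (n + k)) (p := assignNat _ _)
        (R := fun s' => s'.nat 11 0 = 0) (runs_setNat (by simp [NExpr.cost])
          (by simp [NExpr.eval])) ?_ (by omega)
      intro t1 ht1 hg1
      refine runs_seq_frame (T₁ := 60 * (n + k)) (T₂ := 4)
        (R := fun s' => s'.nat 11 0 = (n + k) * (n + k) ^ i) ?_ ?_ (by omega)
      · refine runs_forLoop (T := 10) (b := n + k) (fun j s' => s'.nat 11 0 = j * (n + k) ^ i)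
          (by decide) (by decide) (by decide) (fun _ _ _ h => by simpa using h)
          (by rw [hg1.1 4 (by decide), h54']) (by simp [ht1]) ?_
          ((loop_cost (p := 0) (C := 10) le_rfl hN (by simp)).trans (by simp; omega))
          fun _ h _ => h
        intro j s'' hj hJ hs'' hg
        refine runs_setNat (by simp [NExpr.cost, nvar]) ?_
        simp only [NExpr.eval, nvar, hJ, State.writeNat_nat_same, Function.update_self,
          hg.1 10 (by decide), hg1.1 10 (by decide), hI]
        ring
      · intro t2 ht2 hg2
        refine runs_setNat (by simp [NExpr.cost, nvar]) ?_
        simp only [NExpr.eval, nvar, ht2, State.writeNat_nat_same, Function.update_self]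
        ring
    · rw [hf6.1 4 (by decide), h54]
    · rw [hf6.1 5 (by decide), hf5.1 5 (by decide), hf4.1 5 (by decide), hf3.1 5 (by decide)]
      exact h2
    · rw [hf6.2 4 (by decide), hf5.2 4 (by decide), h4]
  · rintro s ⟨h4, h5, hfact, h10⟩ hf
    refine ⟨⟨hn, Nat.le_add_right n k, ?_, h4, fun j => h5 j j.2.le, fun j i => ?_, hfact⟩, ?_,
      h10, fun i => ?_, ⟨?_, ?_, fun l hl => absurd hl (Nat.not_lt_zero _), ?_⟩⟩
    · rw [hf.1 0 (by decide)]; simp [inputState]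
    · rw [hf.2 0 (by decide)]
      have hlt : (j : ℕ) * n + i < (n + k) * n := by
        calc (j : ℕ) * n + i < j * n + n := by omega
          _ = (j + 1) * n := by ring
          _ ≤ (n + k) * n := Nat.mul_le_mul_right _ j.2
      simp only [inputState, true_and]
      rw [dif_pos hlt]
      congr 1
      · ext
        change ((j : ℕ) * n + i) / n = j
        rw [add_comm, Nat.add_mul_div_right _ _ hn, Nat.div_eq_of_lt i.2, zero_add]
      · ext
        change ((j : ℕ) * n + i) % n = i
        rw [add_comm, Nat.add_mul_mod_self_right, Nat.mod_eq_of_lt i.2]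
    · rw [hf.1 1 (by decide)]; simp [inputState]
    · rw [hf.1 6 (by decide)]; simp [inputState]
    · rw [hf.1 2 (by decide)]; simp [inputState]
    · rw [hf.1 9 (by decide)]; simp [inputState]
    · rw [hf.2 1 (by decide)]; simp [inputState]

/-- The program that lists the simplices of a decomposition and sums up their volumes. -/
def volumeProg : Prog := Prog.seq prepare (forLoop 20 10 roundProg)

theorem runs_volumeProg (hn : 1 ≤ n) (V : Fin (n + k) → Fin n → ℝ) :
    Runs volumeProg (3000 * (n + k) ^ (k + 3)) (inputState V) fun s =>
      ∃ L, Listed V L s ∧ ListsFeasible V ((n + k) ^ k) L := by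
  have hN : 1 ≤ n + k := by omega
  have hN2 : (n + k) ^ 2 ≤ (n + k) ^ (k + 3) := Nat.pow_le_pow_right hN (by omega)
  refine runs_seq_frame (T₂ := 2500 * (n + k) ^ (k + 3)) (runs_prepare hn V) ?_ (by omega)
  intro s ⟨hE, hk, h10, h6, hL⟩ _
  refine runs_forLoop (T := 2000 * (n + k) ^ 3) (b := (n + k) ^ k) (fun m s' =>
      (∀ i < k, s'.nat 6 i = m / (n + k) ^ i % (n + k)) ∧
      ∃ L, Listed V L s' ∧ ListsFeasible V m L)
    (by decide) (by decide) (by decide) ?_ h10 ?_ ?_ ?_ fun _ h _ => h.2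
  · rintro m s' v ⟨h, L, hL, hF⟩
    exact ⟨by simpa using h, L, ⟨by simpa using hL.count, by simpa using hL.pointer,
      by simpa using hL.entry, hL.volume⟩, hF⟩
  · exact ⟨fun i _ => by rw [h6]; simp, [], hL, List.nodup_nil, fun W => by simp⟩
  · rintro m s' hm ⟨hd, L, hL', hF⟩ _ hf
    exact runs_roundProg (hE.of_frame hf (by decide) (by decide))
      (by rw [hf.1 1 (by decide), hk]) hm hd hL' hF
  · have h3 : 1 ≤ (n + k) ^ 3 := Nat.one_le_pow _ _ hN
    have h4 : 1 ≤ (n + k) ^ (k + 3) := Nat.one_le_pow _ _ hN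
    -- There are `N ^ k` tuples, and the cubic elimination dominates each round.
    calc (n + k) ^ k * (2000 * (n + k) ^ 3 + 13) + 10
        ≤ (n + k) ^ k * (2013 * (n + k) ^ 3) + 10 * (n + k) ^ (k + 3) :=
          Nat.add_le_add (Nat.mul_le_mul_left _ (by omega)) (by omega)
      _ = 2023 * (n + k) ^ (k + 3) := by ring
      _ ≤ 2500 * (n + k) ^ (k + 3) := Nat.mul_le_mul_right _ (by norm_num)

/-- Every increasing family of `n` out of `n + k` indices has a complementary family. -/
theorem exists_complementary {W : Fin n → Fin (n + k)} (hW : StrictMono W) :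
    ∃ e : Fin ((n + k) ^ k), Complementary (finFunctionFinEquiv.symm e) W := by
  classical
  have hcard : ((Finset.univ.image W)ᶜ).card = k := by
    rw [Finset.card_compl, Finset.card_image_of_injective _ hW.injective]
    simp
  refine ⟨finFunctionFinEquiv ((Finset.univ.image W)ᶜ.orderEmbOfFin hcard), ?_⟩
  rw [Equiv.symm_apply_apply]
  refine ⟨OrderEmbedding.strictMono _, hW, ?_⟩
  rw [Finset.range_orderEmbOfFin]
  simp

end RealRAM

end

/-! ### The theorem -/

open RealRAM in
theorem mainTheorem5 :
    ∃ p : RealRAM.Prog, ∀ k : ℕ, 1 ≤ k → ∃ C : ℕ, ∀ n : ℕ, 1 ≤ n →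
      ∀ V : Fin (n + k) → Fin n → ℝ, 0 ∈ interior (vPolytope V) →
        ∃ (t : ℕ) (s : RealRAM.State),
          RealRAM.Exec p (inputState V) t s ∧
          t ≤ C * n ^ (k + 3) ∧
          realOutput s = (MeasureTheory.volume (vPolytope V)).toReal ∧
          ∃ U : Fin (simplexCount s) → Fin n → Fin (n + k),
            ListsSimplices s U ∧
            IsDecomposition V U ∧
            realOutput s = ∑ l, |(columnMatrix V (U l)).det| / (n.factorial : ℝ) := by
  -- The factor `(k + 1) ^ (k + 3)` comes from `n + k ≤ (k + 1) * n`, valid for `n ≥ 1`.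
  refine ⟨volumeProg, fun k hk => ⟨3000 * (k + 1) ^ (k + 3), fun n hn V h0 => ?_⟩⟩
  obtain ⟨t, s, hexec, ht, L, hL, hnodup, hmem⟩ := runs_volumeProg hn V
  have hlen : simplexCount s = L.length := hL.count
  let U : Fin (simplexCount s) → Fin n → Fin (n + k) := fun l => L.get (Fin.cast hlen l)
  have hdec : IsDecomposition V U := by
    refine isDecomposition_of_lexFeasible hn h0 ?_ fun W => ?_
    · exact (List.nodup_iff_injective_get.1 hnodup).comp (Fin.cast_injective hlen)
    · constructor
      · rintro ⟨l, rfl⟩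
        obtain ⟨h1, e, -, h2⟩ := (hmem _).1 (L.get_mem (Fin.cast hlen l))
        exact ⟨h2.2.1, h1⟩
      · rintro ⟨h1, h2⟩
        -- Every feasible index set is listed because the increasing enumeration of its complement
        -- is one of the `N ^ k` tuples.
        obtain ⟨e, he⟩ := exists_complementary h1
        obtain ⟨l, hl⟩ := List.get_of_mem ((hmem W).2 ⟨h2, e, e.2, he⟩)
        exact ⟨Fin.cast hlen.symm l, hl⟩
  have hsum : realOutput s = ∑ l, |(columnMatrix V (U l)).det| / (n.factorial : ℝ) := by
    have h1 : ∑ l : Fin (simplexCount s), |(columnMatrix V (U l)).det| / (n.factorial : ℝ) =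
        ∑ l : Fin L.length, |(columnMatrix V (L.get l)).det| / (n.factorial : ℝ) :=
      (finCongr hlen).sum_comp fun l => |(columnMatrix V (L.get l)).det| / (n.factorial : ℝ)
    rw [h1]
    refine hL.volume.trans ?_
    simp [← Fin.sum_univ_fun_getElem]
  refine ⟨t, s, hexec, ht.trans ?_, hsum.trans (hdec.volume_eq hn).symm, U, ?_, hdec, hsum⟩
  · rw [mul_assoc, ← mul_pow]
    refine Nat.mul_le_mul_left _ (Nat.pow_le_pow_left ?_ _)
    nlinarith
  · intro l i
    exact hL.entry l (by rw [← hlen]; exact l.2) i
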